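/- Let $1\le k\le n$ be integers, let $\mathcal X,\mathcal Y$ be measurable spaces, let $X_1,\dots,X_n$ be i.i.d. $\mathcal X$-valued random variables and let $(Y_{i,j})_{1\le i<j\le n}$ be i.i.d. $\mathcal Y$-valued random variables, the two families being independent of each other; put $Y_{j,i}=Y_{i,j}$ for $i<j$. Let $f:\mathcal X^k\times\mathcal Y^{k(k-1)/2}\to\mathbb R$ be a measurable function that is symmetric, i.e. for every permutation $\pi$ of $\{1,\dots,k\}$, all $x_1,\dots,x_k\in\mathcal X$ and all $y_{i,j}=y_{j,i}\in\mathcal Y$ $(i\ne j)$, $$f(x_{\pi(1)},\dots,x_{\pi(k)};y_{\pi(1),\pi(2)},\dots,y_{\pi(k-1),\pi(k)})=f(x_1,\dots,x_k;y_{1,2},\dots,y_{k-1,k}).$$ Write $f(X_{[k]};Y_{[k]_2})=f(X_1,\dots,X_k;Y_{1,2},\dots,Y_{k-1,k})$, assume $\mathbb E\,f(X_{[k]};Y_{[k]_2})^2<\infty$, and let $$S_{n,k}(f)=\sum_{1\le\alpha(1)<\dots<\alpha(k)\le n}f(X_{\alpha(1)},\dots,X_{\alpha(k)};Y_{\alpha(1),\alpha(2)},\dots,Y_{\alpha(k-1),\alpha(k)}),$$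 $$f_1(x)=\mathbb E\{f(X_{[k]};Y_{[k]_2})\mid X_1=x\}-\mathbb E\{f(X_{[k]};Y_{[k]_2})\}.$$ With $\|Z\|_p=(\mathbb E|Z|^p)^{1/p}\in[0,\infty]$, suppose that $\sigma_1:=\|f_1(X_1)\|_2>0$. Then $$\sup_{z\in\mathbb R}\left|\mathbb P\left[\frac{S_{n,k}(f)-\mathbb E\{S_{n,k}(f)\}}{\sqrt{\operatorname{Var}\{S_{n,k}(f)\}}}\le z\right]-\Phi(z)\right|\le\frac{12k\,\|f(X_{[k]};Y_{[k]_2})\|_4^2}{\sqrt n\,\sigma_1^2},$$ where $\Phi$ is the distribution function of $N(0,1)$ (the bound is trivially true when $\|f(X_{[k]};Y_{[k]_2})\|_4=\infty$). -/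

import Mathlib

open MeasureTheory ProbabilityTheory
open scoped ENNReal

namespace GenUStat

/-- The two-element subsets of `{0, …, n - 1}`, i.e. the pairs of indices `i < j`. Unordered pairs
are used so that the convention `Y_{j,i} = Y_{i,j}` is built in. -/
abbrev Edge (n : ℕ) : Type := {e : Sym2 (Fin n) // ¬ e.IsDiag}

/-- The map `{i, j} ↦ {α i, α j}` induced on pairs by an injective map of indices. -/
def Edge.map {k n : ℕ} (α : Fin k ↪ Fin n) (e : Edge k) : Edge n :=
  ⟨Sym2.map α e.1, fun h => e.2 ((Sym2.isDiag_map α.injective).1 h)⟩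

/-- A kernel `f : 𝒳 ^ k × 𝒴 ^ (k (k - 1) / 2) → ℝ` is symmetric if it is invariant under every
permutation of the `k` indices, acting simultaneously on the points and on the pairs. -/
def IsSymmetricKernel {𝒳 𝒴 : Type*} {k : ℕ} (f : (Fin k → 𝒳) → (Edge k → 𝒴) → ℝ) : Prop :=
  ∀ (π : Equiv.Perm (Fin k)) (x : Fin k → 𝒳) (y : Edge k → 𝒴),
    f (fun i => x (π i)) (fun e => y (e.map π.toEmbedding)) = f x y

section

variable {Ω 𝒳 𝒴 : Type*} {k n : ℕ}

/-- The random variable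
`f (X_{α(1)}, …, X_{α(k)}; Y_{α(1),α(2)}, …, Y_{α(k-1),α(k)})`. -/
def kernelAt (f : (Fin k → 𝒳) → (Edge k → 𝒴) → ℝ) (X : Fin n → Ω → 𝒳) (Y : Edge n → Ω → 𝒴)
    (α : Fin k ↪ Fin n) (ω : Ω) : ℝ :=
  f (fun i => X (α i) ω) (fun e => Y (e.map α) ω)

open Classical in
/-- The generalized `U`-statistic `S_{n,k}(f)`: the sum of `kernelAt f X Y α` over all strictly
increasing `α : {1, …, k} → {1, …, n}`. -/
noncomputable def genUStat (f : (Fin k → 𝒳) → (Edge k → 𝒴) → ℝ) (X : Fin n → Ω → 𝒳)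
    (Y : Edge n → Ω → 𝒴) (ω : Ω) : ℝ :=
  ∑ α : {α : Fin k ↪ Fin n // StrictMono α}, kernelAt f X Y α.1 ω

/-- The random variable `f(X_{[k]}; Y_{[k]_2}) = f (X_1, …, X_k; Y_{1,2}, …, Y_{k-1,k})`. -/
def kernelInit (f : (Fin k → 𝒳) → (Edge k → 𝒴) → ℝ) (X : Fin n → Ω → 𝒳) (Y : Edge n → Ω → 𝒴)
    (hkn : k ≤ n) : Ω → ℝ :=
  kernelAt f X Y (Fin.castLEEmb hkn)

/-- The random variable `f₁(X₁) = E[f(X_{[k]}; Y_{[k]_2}) | X₁] - E[f(X_{[k]}; Y_{[k]_2})]`. The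
index `1` of the text is the index `0` of `Fin n`. -/
noncomputable def firstProjection [MeasurableSpace Ω] [m𝒳 : MeasurableSpace 𝒳] (P : Measure Ω)
    (f : (Fin k → 𝒳) → (Edge k → 𝒴) → ℝ) (X : Fin n → Ω → 𝒳) (Y : Edge n → Ω → 𝒴)
    (hk : 1 ≤ k) (hkn : k ≤ n) (ω : Ω) : ℝ :=
  (P[kernelInit f X Y hkn | m𝒳.comap (X ⟨0, lt_of_lt_of_le hk hkn⟩)]) ω
    - ∫ ω', kernelInit f X Y hkn ω' ∂P

end

end GenUStat

/-! Write `M = (n - 1).choose (k - 1)`. The Hoeffding decomposition of first order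
(`kernelSum_sub_integral`) splits the centred statistic into `M * ∑ i, f₁ (X i)` and a sum of
degenerate kernels, whose conditional mean given any single point vanishes. Two index sets with at
most one common index share no label, so given the common point their kernels are independent, hence
orthogonal (`IsDegenerate.integral_mul_eq_zero`). Second moments of the degenerate part therefore
involve only pairs of index sets with two common indices, at most `k ^ 2 * M ^ 2 / 2` pairs. As the
standard deviation of the statistic is at least `M * √n * σ₁`, the normalized degenerate part is of
order `ε = k * ‖f‖₄² / (√n * σ₁²)` in `L²`.

What remains is a sum `W = ∑ i, g i + R` of independent centred terms and a small remainder, treated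
by Stein's method (`abs_measure_le_sub_stdCdf_le`). If `h` solves `h' w - w * h w = 1_{w ≤ z} - Φ
z`, then `P (W ≤ z) - Φ z` is the mean of `h' W - W * h W`. Swapping the `i`-th point with that of
an independent copy turns `W` into some `W i` and changes the sign of `D i`, the difference between
`g i` and its copy. Hence `E (g i * h W) = E (D i * (h W - h (W i))) / 2`. To first order this is `E
(D i ^ 2 * h' W) / 2`, up to the interaction of `g i` with `R`; integrating out the copy leaves `g i
^ 2 + E (g i ^ 2)`, and half the sum of these is close to `1`.

Since `h'` jumps at `z`, the expansion error needs care. The derivative is an increasing function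
plus a decreasing indicator, so the error is at most the step times the increment of one bounded
increasing function (`abs_steinSol_sub_sub_le`). Using antisymmetry once more, the total error
becomes `E |∑ i, |D i| * D i|` plus interaction terms. The variables `|D i| * D i` are orthogonal,
so this has size `√(n * E g ^ 4)`, which is where the fourth moment enters; no concentration
inequality is needed. -/

namespace GenUStat

/-! ### Stein's equation for the standard normal distribution -/

section Stein

open Filter Topology Set

/-- The density of the standard normal distribution. -/
noncomputable abbrev stdPdf : ℝ → ℝ := gaussianPDFReal 0 1

/-- The distribution function of the standard normal distribution. -/
noncomputable abbrev stdCdf (z : ℝ) : ℝ := cdf (gaussianReal 0 1) z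

lemma stdPdf_pos (w : ℝ) : 0 < stdPdf w := gaussianPDFReal_pos 0 1 w one_ne_zero

lemma stdPdf_eq (w : ℝ) : stdPdf w = (√(2 * Real.pi))⁻¹ * Real.exp (-w ^ 2 / 2) := by
  simp [stdPdf, gaussianPDFReal]

lemma hasDerivAt_stdPdf (w : ℝ) : HasDerivAt stdPdf (-w * stdPdf w) w := by
  have h : stdPdf = fun w => (√(2 * Real.pi))⁻¹ * Real.exp (-w ^ 2 / 2) := funext stdPdf_eq
  rw [h]
  have h1 : HasDerivAt (fun w : ℝ => -w ^ 2 / 2) (-w) w := by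
    refine (((hasDerivAt_pow 2 w).neg).div_const 2).congr_deriv ?_
    norm_num
    ring
  refine (h1.exp.const_mul ((√(2 * Real.pi))⁻¹)).congr_deriv ?_
  ring

lemma continuous_stdPdf : Continuous stdPdf :=
  continuous_iff_continuousAt.2 fun w => (hasDerivAt_stdPdf w).continuousAt

lemma stdPdf_neg (w : ℝ) : stdPdf (-w) = stdPdf w := by
  rw [stdPdf_eq, stdPdf_eq]; simp

lemma stdPdf_le_one (w : ℝ) : stdPdf w ≤ 1 := by
  rw [stdPdf_eq]
  have h1 : (√(2 * Real.pi))⁻¹ ≤ 1 := by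
    apply inv_le_one_of_one_le₀
    rw [Real.one_le_sqrt]
    linarith [Real.pi_gt_three]
  have h2 : Real.exp (-w ^ 2 / 2) ≤ 1 := by
    rw [Real.exp_le_one_iff]
    nlinarith [sq_nonneg w]
  have h3 : 0 ≤ (√(2 * Real.pi))⁻¹ := by positivity
  nlinarith [Real.exp_pos (-w ^ 2 / 2)]

lemma stdCdf_eq_integral (w : ℝ) : stdCdf w = ∫ x in Iic w, stdPdf x := by
  rw [stdCdf, cdf_eq_real, measureReal_def, gaussianReal_apply_eq_integral 0 one_ne_zero,
    ENNReal.toReal_ofReal]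
  exact integral_nonneg fun x => (stdPdf_pos x).le

lemma hasDerivAt_stdCdf (w : ℝ) : HasDerivAt stdCdf (stdPdf w) w := by
  have hint : Integrable stdPdf := integrable_gaussianPDFReal 0 1
  have h : stdCdf = fun w => (∫ x in (0 : ℝ)..w, stdPdf x) + stdCdf 0 := by
    funext w
    rw [stdCdf_eq_integral, stdCdf_eq_integral,
      ← intervalIntegral.integral_Iic_sub_Iic hint.integrableOn hint.integrableOn]
    ring
  rw [h]
  exact (intervalIntegral.integral_hasDerivAt_right hint.intervalIntegrable
    (continuous_stdPdf.stronglyMeasurableAtFilter _ _) continuous_stdPdf.continuousAt).add_const _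

lemma stdCdf_neg (w : ℝ) : stdCdf (-w) = 1 - stdCdf w := by
  have hint : Integrable stdPdf := integrable_gaussianPDFReal 0 1
  have h1 : stdCdf (-w) = ∫ x in Ioi w, stdPdf x := by
    rw [stdCdf_eq_integral, ← integral_comp_neg_Ioi]
    simp only [stdPdf_neg]
  have h2 := intervalIntegral.integral_Iic_add_Ioi (b := w) (f := stdPdf) (μ := volume)
    hint.integrableOn hint.integrableOn
  rw [integral_gaussianPDFReal_eq_one 0 one_ne_zero] at h2
  rw [h1, stdCdf_eq_integral]
  linarith

lemma stdCdf_nonneg (w : ℝ) : 0 ≤ stdCdf w := cdf_nonneg _ w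

lemma stdCdf_le_one (w : ℝ) : stdCdf w ≤ 1 := cdf_le_one _ w

lemma stdCdf_mono : Monotone stdCdf := monotone_cdf _

lemma stdCdf_zero : stdCdf 0 = 1 / 2 := by
  have := stdCdf_neg 0
  rw [neg_zero] at this
  linarith

/-- The ratio of the standard normal distribution function to its density. -/
noncomputable def millsRatio (w : ℝ) : ℝ := stdCdf w / stdPdf w

lemma millsRatio_nonneg (w : ℝ) : 0 ≤ millsRatio w :=
  div_nonneg (stdCdf_nonneg w) (stdPdf_pos w).le

lemma hasDerivAt_millsRatio (w : ℝ) : HasDerivAt millsRatio (1 + w * millsRatio w) w := by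
  have h := (hasDerivAt_stdCdf w).div (hasDerivAt_stdPdf w) (stdPdf_pos w).ne'
  refine h.congr_deriv ?_
  have := (stdPdf_pos w).ne'
  rw [millsRatio]
  field_simp
  ring

/-- For negative arguments `Φ u + φ u / u` has derivative `-φ u / u ^ 2` and limit `0` at `-∞`,
hence is nonpositive: the classical tail bound `Φ w ≤ φ w / |w|`. The expression is the derivative
of `millsRatio`. -/
lemma one_add_mul_millsRatio_nonneg (w : ℝ) : 0 ≤ 1 + w * millsRatio w := by
  rcases le_or_gt 0 w with hw | hw
  · have := mul_nonneg hw (millsRatio_nonneg w)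
    linarith
  have hder : ∀ u : ℝ, u ≠ 0 →
      HasDerivAt (fun u => stdCdf u + stdPdf u / u) (-stdPdf u / u ^ 2) u := by
    intro u hu
    have h := (hasDerivAt_stdCdf u).add ((hasDerivAt_stdPdf u).div (hasDerivAt_id u) hu)
    refine h.congr_deriv ?_
    simp only [id]
    field_simp
    ring
  have hanti : AntitoneOn (fun u => stdCdf u + stdPdf u / u) (Iic w) := by
    apply antitoneOn_of_deriv_nonpos (convex_Iic w)
    · intro u hu
      exact (hder u (lt_of_le_of_lt hu hw).ne).continuousAt.continuousWithinAt
    · intro u hu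
      rw [interior_Iic] at hu
      exact (hder u (lt_trans hu hw).ne).differentiableAt.differentiableWithinAt
    · intro u hu
      rw [interior_Iic] at hu
      rw [(hder u (lt_trans hu hw).ne).deriv]
      have := stdPdf_pos u
      rw [neg_div, neg_nonpos]
      positivity
  have hlim : Tendsto (fun u => stdCdf u + stdPdf u / u) atBot (𝓝 0) := by
    rw [← add_zero (0 : ℝ)]
    refine (tendsto_cdf_atBot _).add ?_
    have h1 : Tendsto (fun u : ℝ => |u⁻¹|) atBot (𝓝 0) := by
      simpa using (tendsto_inv_atBot_zero (𝕜 := ℝ)).abs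
    refine squeeze_zero_norm (fun u => ?_) h1
    rw [Real.norm_eq_abs, abs_div, abs_inv, div_eq_mul_inv, abs_of_pos (stdPdf_pos u)]
    exact mul_le_of_le_one_left (by positivity) (stdPdf_le_one u)
  have hle : stdCdf w + stdPdf w / w ≤ 0 := by
    refine ge_of_tendsto hlim ?_
    filter_upwards [eventually_le_atBot w] with u hu
    exact hanti hu (mem_Iic.2 le_rfl) hu
  have hp := stdPdf_pos w
  have h2 : 1 + w * millsRatio w = w * (stdCdf w + stdPdf w / w) / stdPdf w := by
    rw [millsRatio]
    have := hw.ne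
    field_simp
    ring
  rw [h2]
  exact div_nonneg (mul_nonneg_of_nonpos_of_nonpos hw.le hle) hp.le

lemma millsRatio_mono : Monotone millsRatio :=
  monotone_of_deriv_nonneg (fun w => (hasDerivAt_millsRatio w).differentiableAt) fun w => by
    rw [(hasDerivAt_millsRatio w).deriv]
    exact one_add_mul_millsRatio_nonneg w

lemma hasDerivAt_mul_millsRatio (w : ℝ) :
    HasDerivAt (fun w => w * millsRatio w) (w + (1 + w ^ 2) * millsRatio w) w := by
  refine ((hasDerivAt_id w).mul (hasDerivAt_millsRatio w)).congr_deriv ?_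
  simp only [id]
  ring

/-- The complementary tail bound: `Φ u + φ u * u / (1 + u ^ 2)` increases from its limit `0` at
`-∞`. The expression is the derivative of `w * millsRatio w`. -/
lemma add_mul_millsRatio_nonneg (w : ℝ) : 0 ≤ w + (1 + w ^ 2) * millsRatio w := by
  have hder : ∀ u : ℝ, HasDerivAt (fun u => stdCdf u + stdPdf u * (u / (1 + u ^ 2)))
      (2 * stdPdf u / (1 + u ^ 2) ^ 2) u := by
    intro u
    have hu : 1 + u ^ 2 ≠ 0 := by positivity
    have h := (hasDerivAt_stdCdf u).add ((hasDerivAt_stdPdf u).mul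
      ((hasDerivAt_id u).div (((hasDerivAt_pow 2 u)).const_add 1) hu))
    refine h.congr_deriv ?_
    simp only [id, Pi.div_apply]
    field_simp
    ring
  have hmono : Monotone (fun u => stdCdf u + stdPdf u * (u / (1 + u ^ 2))) := by
    refine monotone_of_deriv_nonneg (fun u => (hder u).differentiableAt) fun u => ?_
    rw [(hder u).deriv]
    have := stdPdf_pos u
    positivity
  have hlim : Tendsto (fun u => stdCdf u + stdPdf u * (u / (1 + u ^ 2))) atBot (𝓝 0) := by
    rw [← add_zero (0 : ℝ)]
    refine (tendsto_cdf_atBot _).add ?_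
    have h1 : Tendsto (fun u : ℝ => |u⁻¹|) atBot (𝓝 0) := by
      simpa using (tendsto_inv_atBot_zero (𝕜 := ℝ)).abs
    refine squeeze_zero_norm' ?_ h1
    filter_upwards [eventually_lt_atBot 0] with u hu
    rw [Real.norm_eq_abs, abs_mul, abs_of_pos (stdPdf_pos u)]
    have h3 : |u / (1 + u ^ 2)| ≤ |u⁻¹| := by
      rw [abs_div, abs_inv, abs_of_pos (by positivity : 0 < 1 + u ^ 2), div_le_iff₀ (by positivity),
        abs_of_neg hu, inv_neg]
      have : -u⁻¹ * (1 + u ^ 2) = -u⁻¹ + -u := by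
        have := hu.ne
        field_simp
        ring
      rw [this]
      have : u⁻¹ < 0 := inv_lt_zero.2 hu
      linarith
    exact (mul_le_of_le_one_left (abs_nonneg _) (stdPdf_le_one u)).trans h3
  have hge : 0 ≤ stdCdf w + stdPdf w * (w / (1 + w ^ 2)) := by
    refine le_of_tendsto hlim ?_
    filter_upwards [eventually_le_atBot w] with u hu
    exact hmono hu
  have hp := stdPdf_pos w
  have h2 : w + (1 + w ^ 2) * millsRatio w
      = (1 + w ^ 2) * (stdCdf w + stdPdf w * (w / (1 + w ^ 2))) / stdPdf w := by
    rw [millsRatio]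
    field_simp
    ring
  rw [h2]
  positivity

lemma mul_millsRatio_mono : Monotone fun w => w * millsRatio w :=
  monotone_of_deriv_nonneg (fun w => (hasDerivAt_mul_millsRatio w).differentiableAt) fun w => by
    rw [(hasDerivAt_mul_millsRatio w).deriv]
    exact add_mul_millsRatio_nonneg w

lemma millsRatio_zero_le : millsRatio 0 ≤ 1.26 := by
  rw [millsRatio, stdCdf_zero, stdPdf_eq]
  simp only [ne_eq, OfNat.ofNat_ne_zero, not_false_eq_true, zero_pow, neg_zero, zero_div,
    Real.exp_zero, mul_one, div_inv_eq_mul]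
  have : √(2 * Real.pi) ≤ 2.52 := by
    rw [Real.sqrt_le_left (by norm_num)]
    linarith [Real.pi_lt_d2]
  linarith

/-- The solution of Stein's equation `h' w - w * h w = 1_{w ≤ z} - Φ z`. -/
noncomputable def steinSol (z w : ℝ) : ℝ :=
  if w ≤ z then (1 - stdCdf z) * millsRatio w else stdCdf z * millsRatio (-w)

/-- The indicator of `(-∞, z]`, with real values. -/
noncomputable def iicInd (z w : ℝ) : ℝ := if w ≤ z then 1 else 0

/-- The derivative of `steinSol z`. -/
noncomputable def steinDeriv (z w : ℝ) : ℝ := w * steinSol z w + iicInd z w - stdCdf z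

/-- The difference of the increasing and decreasing parts of `steinDeriv z`, centred. -/
noncomputable def steinMono (z w : ℝ) : ℝ := w * steinSol z w - iicInd z w + 1 - stdCdf z

variable {z : ℝ}

lemma steinSol_of_le {w : ℝ} (h : w ≤ z) : steinSol z w = (1 - stdCdf z) * millsRatio w :=
  if_pos h

/-- Both branches agree at `z`, because `φ` is even and `Φ (-z) = 1 - Φ z`; this is the continuity
of the solution. -/
lemma steinSol_of_ge {w : ℝ} (h : z ≤ w) : steinSol z w = stdCdf z * millsRatio (-w) := by
  rcases h.eq_or_lt with rfl | h
  · rw [steinSol_of_le le_rfl, millsRatio, millsRatio, stdPdf_neg, stdCdf_neg]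
    ring
  · exact if_neg (not_le.2 h)

lemma iicInd_of_le {w : ℝ} (h : w ≤ z) : iicInd z w = 1 := if_pos h

lemma iicInd_of_gt {w : ℝ} (h : z < w) : iicInd z w = 0 := if_neg (not_le.2 h)

lemma iicInd_anti (z : ℝ) : Antitone (iicInd z) := by
  intro a b hab
  rcases le_or_gt b z with hb | hb
  · rw [iicInd_of_le hb, iicInd_of_le (hab.trans hb)]
  · rw [iicInd_of_gt hb]
    unfold iicInd; split_ifs <;> norm_num

lemma steinSol_nonneg (z w : ℝ) : 0 ≤ steinSol z w := by
  have h1 := stdCdf_nonneg z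
  have h2 := stdCdf_le_one z
  rcases le_total w z with h | h
  · rw [steinSol_of_le h]
    exact mul_nonneg (by linarith) (millsRatio_nonneg _)
  · rw [steinSol_of_ge h]
    exact mul_nonneg (by linarith) (millsRatio_nonneg _)

/-- Monotonicity of `Φ` bounds the solution by both `millsRatio w` and `millsRatio (-w)`; whichever
has a nonpositive argument is at most `millsRatio 0 = √(2π) / 2 < 1.26`. -/
lemma steinSol_le (z w : ℝ) : steinSol z w ≤ 1.26 := by
  refine le_trans ?_ millsRatio_zero_le
  have key : steinSol z w ≤ millsRatio w ∧ steinSol z w ≤ millsRatio (-w) := by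
    have hp := stdPdf_pos w
    have h1 := stdCdf_nonneg z
    have h2 := stdCdf_le_one z
    have h3 := millsRatio_nonneg w
    have h4 := millsRatio_nonneg (-w)
    have h5 := stdCdf_nonneg w
    have h6 := stdCdf_le_one w
    rcases le_total w z with h | h
    · rw [steinSol_of_le h]
      refine ⟨by nlinarith, ?_⟩
      rw [millsRatio, millsRatio, stdPdf_neg, stdCdf_neg, mul_div_assoc', div_le_div_iff_of_pos_right hp]
      have := stdCdf_mono h
      nlinarith
    · rw [steinSol_of_ge h]
      refine ⟨?_, by nlinarith⟩
      rw [millsRatio, millsRatio, stdPdf_neg, stdCdf_neg, mul_div_assoc', div_le_div_iff_of_pos_right hp]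
      have := stdCdf_mono h
      nlinarith
  rcases le_total w 0 with h | h
  · exact key.1.trans (millsRatio_mono h)
  · exact key.2.trans (millsRatio_mono (by linarith))

lemma abs_steinSol_le (z w : ℝ) : |steinSol z w| ≤ 1.26 := by
  rw [abs_of_nonneg (steinSol_nonneg z w)]
  exact steinSol_le z w

lemma mul_steinSol_mono (z : ℝ) : Monotone fun w => w * steinSol z w := by
  have h1 := stdCdf_nonneg z
  have h2 := stdCdf_le_one z
  have hl : ∀ a b, a ≤ b → b ≤ z → a * steinSol z a ≤ b * steinSol z b := by
    intro a b hab hb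
    rw [steinSol_of_le hb, steinSol_of_le (hab.trans hb)]
    have := mul_millsRatio_mono hab
    simp only at this
    nlinarith
  have hr : ∀ a b, a ≤ b → z ≤ a → a * steinSol z a ≤ b * steinSol z b := by
    intro a b hab hb
    rw [steinSol_of_ge hb, steinSol_of_ge (hb.trans hab)]
    have := mul_millsRatio_mono (neg_le_neg hab)
    simp only at this
    nlinarith
  intro a b hab
  rcases le_total b z with hb | hb
  · exact hl a b hab hb
  rcases le_total a z with ha | ha
  · exact (hl a z ha le_rfl).trans (hr z b hb le_rfl)
  · exact hr a b hab ha

lemma neg_le_mul_steinSol (z w : ℝ) : -(1 - stdCdf z) ≤ w * steinSol z w := by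
  have h2 := stdCdf_le_one z
  have h (w : ℝ) (hw : w ≤ z) : -(1 - stdCdf z) ≤ w * steinSol z w := by
    rw [steinSol_of_le hw]
    have := one_add_mul_millsRatio_nonneg w
    nlinarith
  rcases le_total w z with hw | hw
  · exact h w hw
  · exact (h z le_rfl).trans (mul_steinSol_mono z hw)

lemma mul_steinSol_le (z w : ℝ) : w * steinSol z w ≤ stdCdf z := by
  have h2 := stdCdf_nonneg z
  have h (w : ℝ) (hw : z ≤ w) : w * steinSol z w ≤ stdCdf z := by
    rw [steinSol_of_ge hw]
    have := one_add_mul_millsRatio_nonneg (-w)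
    nlinarith
  rcases le_total z w with hw | hw
  · exact h w hw
  · exact (mul_steinSol_mono z hw).trans (h z le_rfl)

/-- As `w * steinSol z w` lies in `[-(1 - Φ z), Φ z]`, the derivative lies in `[0, 1]` up to `z` and
in `[-1, 0]` beyond it. -/
lemma abs_steinDeriv_le (z w : ℝ) : |steinDeriv z w| ≤ 1 := by
  rw [steinDeriv, abs_le]
  have h1 := stdCdf_nonneg z
  have h2 := stdCdf_le_one z
  have h3 := neg_le_mul_steinSol z w
  have h4 := mul_steinSol_le z w
  have h5 : w ≤ z → w * steinSol z w ≤ z * steinSol z z := fun h => mul_steinSol_mono z h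
  rcases le_or_gt w z with h | h
  · rw [iicInd_of_le h]; constructor <;> linarith
  · rw [iicInd_of_gt h]; constructor <;> linarith

lemma abs_steinMono_le (z w : ℝ) : |steinMono z w| ≤ 1 := by
  rw [steinMono, abs_le]
  have h1 := stdCdf_nonneg z
  have h2 := stdCdf_le_one z
  have h3 := neg_le_mul_steinSol z w
  have h4 := mul_steinSol_le z w
  rcases le_or_gt w z with h | h
  · rw [iicInd_of_le h]; constructor <;> linarith
  · rw [iicInd_of_gt h]; constructor <;> linarith

lemma measurable_iicInd (z : ℝ) : Measurable (iicInd z) :=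
  Measurable.ite measurableSet_Iic measurable_const measurable_const

lemma continuous_millsRatio : Continuous millsRatio :=
  continuous_iff_continuousAt.2 fun w => (hasDerivAt_millsRatio w).continuousAt

lemma measurable_steinSol (z : ℝ) : Measurable (steinSol z) :=
  Measurable.ite measurableSet_Iic (continuous_millsRatio.measurable.const_mul _)
    ((continuous_millsRatio.measurable.comp measurable_neg).const_mul _)

lemma measurable_steinDeriv (z : ℝ) : Measurable (steinDeriv z) :=
  ((measurable_id.mul (measurable_steinSol z)).add (measurable_iicInd z)).sub_const _

lemma measurable_steinMono (z : ℝ) : Measurable (steinMono z) :=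
  (((measurable_id.mul (measurable_steinSol z)).sub (measurable_iicInd z)).add_const _).sub_const _

/-- Away from `z` the derivative is `u * steinSol z u + iicInd z u - Φ z`, an increasing plus a
decreasing function of `u`. Evaluating each at the appropriate endpoint bounds it on the interval;
the mean value inequality is applied on either side of `z` and the pieces are added. -/
lemma mul_sub_le_steinSol_sub (z : ℝ) {a b : ℝ} (hab : a ≤ b) :
    (a * steinSol z a + iicInd z b - stdCdf z) * (b - a) ≤ steinSol z b - steinSol z a ∧
      steinSol z b - steinSol z a ≤ (b * steinSol z b + iicInd z a - stdCdf z) * (b - a) := by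
  have key : ∀ {g : ℝ → ℝ} {g' : ℝ → ℝ} {a b c d : ℝ}, a ≤ b → (∀ u, HasDerivAt g (g' u) u) →
      (∀ u ∈ Ioo a b, c ≤ g' u) → (∀ u ∈ Ioo a b, g' u ≤ d) →
      c * (b - a) ≤ g b - g a ∧ g b - g a ≤ d * (b - a) := by
    intro g g' a b c d hab hg hc hd
    have hcont : ContinuousOn g (Icc a b) := fun u _ => (hg u).continuousAt.continuousWithinAt
    have hdiff : DifferentiableOn ℝ g (interior (Icc a b)) := fun u _ =>
      (hg u).differentiableAt.differentiableWithinAt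
    constructor
    · refine (convex_Icc a b).mul_sub_le_image_sub_of_le_deriv hcont hdiff (fun u hu => ?_) a
        (left_mem_Icc.2 hab) b (right_mem_Icc.2 hab) hab
      rw [interior_Icc] at hu
      rw [(hg u).deriv]
      exact hc u hu
    · refine (convex_Icc a b).image_sub_le_mul_sub_of_deriv_le hcont hdiff (fun u hu => ?_) a
        (left_mem_Icc.2 hab) b (right_mem_Icc.2 hab) hab
      rw [interior_Icc] at hu
      rw [(hg u).deriv]
      exact hd u hu
  have hl : ∀ {a b : ℝ}, a ≤ b → b ≤ z →
      (a * steinSol z a + 1 - stdCdf z) * (b - a) ≤ steinSol z b - steinSol z a ∧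
      steinSol z b - steinSol z a ≤ (b * steinSol z b + 1 - stdCdf z) * (b - a) := by
    intro a b hab hb
    rw [steinSol_of_le hb, steinSol_of_le (hab.trans hb)]
    refine key (g := fun w => (1 - stdCdf z) * millsRatio w) hab
      (fun u => (hasDerivAt_millsRatio u).const_mul _) (fun u hu => ?_) (fun u hu => ?_)
    · have := mul_steinSol_mono z hu.1.le
      simp only [steinSol_of_le (hab.trans hb), steinSol_of_le (hu.2.le.trans hb)] at this
      linarith
    · have := mul_steinSol_mono z hu.2.le
      simp only [steinSol_of_le hb, steinSol_of_le (hu.2.le.trans hb)] at this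
      linarith
  have hr : ∀ {a b : ℝ}, a ≤ b → z ≤ a →
      (a * steinSol z a - stdCdf z) * (b - a) ≤ steinSol z b - steinSol z a ∧
      steinSol z b - steinSol z a ≤ (b * steinSol z b - stdCdf z) * (b - a) := by
    intro a b hab ha
    rw [steinSol_of_ge ha, steinSol_of_ge (ha.trans hab)]
    have hd : ∀ u : ℝ, HasDerivAt (fun w => stdCdf z * millsRatio (-w))
        (stdCdf z * ((1 + (-u) * millsRatio (-u)) * (-1))) u := fun u =>
      ((hasDerivAt_millsRatio (-u)).comp u (hasDerivAt_neg u)).const_mul _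
    refine key (g := fun w => stdCdf z * millsRatio (-w)) hab hd (fun u hu => ?_) (fun u hu => ?_)
    · have := mul_steinSol_mono z hu.1.le
      simp only [steinSol_of_ge ha, steinSol_of_ge (ha.trans hu.1.le)] at this
      linarith
    · have := mul_steinSol_mono z hu.2.le
      simp only [steinSol_of_ge (ha.trans hab), steinSol_of_ge (ha.trans hu.1.le)] at this
      linarith
  rcases le_or_gt b z with hb | hb
  · rw [iicInd_of_le hb, iicInd_of_le (hab.trans hb)]
    exact hl hab hb
  rw [iicInd_of_gt hb]
  rcases le_or_gt a z with ha | ha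
  · rw [iicInd_of_le ha]
    obtain ⟨h1, h2⟩ := hl ha le_rfl
    obtain ⟨h3, h4⟩ := hr hb.le le_rfl
    have h5 := mul_steinSol_mono z ha
    have h6 := mul_steinSol_mono z hb.le
    simp only at h5 h6
    constructor <;> nlinarith
  · rw [iicInd_of_gt ha]
    simpa using hr hab ha.le

/-- The error of the first order expansion of `steinSol z`. -/
lemma abs_steinSol_sub_sub_le (z w w' : ℝ) :
    |steinSol z w - steinSol z w' - (w - w') * steinDeriv z w|
      ≤ (w - w') * (steinMono z w - steinMono z w') := by
  rcases le_total w' w with h | h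
  · obtain ⟨h1, h2⟩ := mul_sub_le_steinSol_sub z h
    have h3 := iicInd_anti z h
    have h4 := mul_steinSol_mono z h
    simp only at h4
    rw [abs_le, steinDeriv, steinMono, steinMono]
    constructor <;> nlinarith
  · obtain ⟨h1, h2⟩ := mul_sub_le_steinSol_sub z h
    have h3 := iicInd_anti z h
    have h4 := mul_steinSol_mono z h
    simp only at h4
    rw [abs_le, steinDeriv, steinMono, steinMono]
    constructor <;> nlinarith

end Stein

/-! ### Stein's method by swapping between independent copies -/

section Swap

variable {E : Type*} [MeasurableSpace E]

lemma integrable_bounded_mul {μ : Measure E} {u b : E → ℝ} {C : ℝ} (hu : Integrable u μ)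
    (hb : Measurable b) (hC : ∀ x, |b x| ≤ C) : Integrable (fun x => u x * b x) μ := by
  simp_rw [mul_comm (u _)]
  exact hu.bdd_mul hb.aestronglyMeasurable (Filter.Eventually.of_forall fun x => hC x)

lemma integrable_of_abs_le {μ : Measure E} [IsFiniteMeasure μ] {b : E → ℝ} {C : ℝ}
    (hb : Measurable b) (hC : ∀ x, |b x| ≤ C) : Integrable b μ := by
  simpa using integrable_bounded_mul (integrable_const (1 : ℝ)) hb hC

/-- Integrals are invariant under measure preserving maps. -/
lemma integral_comp_eq {F : Type*} [MeasurableSpace F] {μ : Measure E} {ν : Measure F} {τ : E → F}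
    (hτ : MeasurePreserving τ μ ν) {u : F → ℝ} (hu : AEStronglyMeasurable u ν) :
    ∫ x, u (τ x) ∂μ = ∫ x, u x ∂ν := by
  rw [← hτ.map_eq] at hu ⊢
  exact (integral_map hτ.measurable.aemeasurable hu).symm

/-- Invariance under `τ` equates the integral with its negative. This is the form in which
exchangeability enters. Integrability is not needed, the integral being `0` without it. -/
lemma integral_eq_zero_of_comp_eq_neg {μ : Measure E} {τ : E → E} (hτ : MeasurePreserving τ μ μ)
    {u : E → ℝ} (hu : AEStronglyMeasurable u μ) (h : ∀ x, u (τ x) = -u x) : ∫ x, u x ∂μ = 0 := by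
  have h1 := integral_comp_eq hτ hu
  simp_rw [h, integral_neg] at h1
  linarith

/-- **Berry-Esseen bound by swapping**: a sum `W = ∑ i, g i + R` is compared with the standard
normal distribution by means of maps `τ i` that swap, between two independent copies, the part of
the randomness on which `g i` depends. -/
theorem abs_measure_le_sub_stdCdf_le {ι : Type*} [Fintype ι] (P : Measure E)
    [IsProbabilityMeasure P] (g : ι → E → ℝ) (R : E → ℝ) (τ : ι → E × E → E × E)
    (hτ : ∀ i, MeasurePreserving (τ i) (P.prod P) (P.prod P)) (hττ : ∀ i p, τ i (τ i p) = p)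
    (hgm : ∀ i, Measurable (g i)) (hRm : Measurable R) (hg : ∀ i, MemLp (g i) 2 P)
    (hR : MemLp R 2 P) (hg0 : ∀ i, ∫ e, g i e ∂P = 0)
    (hgτ : ∀ i p, g i (τ i p).1 = g i p.2)
    (hgj : ∀ i j, j ≠ i → ∀ p, g j (τ i p).1 = g j p.1) (z : ℝ) :
    |P.real {e | ∑ i, g i e + R e ≤ z} - stdCdf z| ≤
      ∫ e, |1 - (∑ i, (g i e ^ 2 + ∫ e', g i e' ^ 2 ∂P)) / 2| ∂P + 1.26 * ∫ e, |R e| ∂P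
        + ∫ p, |∑ i, |g i p.1 - g i p.2| * (g i p.1 - g i p.2)| ∂P.prod P
        + 3 / 2 * ∑ i, ∫ p, |(g i p.1 - g i p.2) * (R p.1 - R (τ i p).1)| ∂P.prod P := by
  classical
  set W : E → ℝ := fun e => ∑ i, g i e + R e with hW
  have hWm : Measurable W := (Finset.measurable_sum _ fun i _ => hgm i).add hRm
  have hW2 : MemLp W 2 P := (memLp_finsetSum _ fun i _ => hg i).add hR
  set Q := P.prod P with hQ
  have hfst : MeasurePreserving (Prod.fst : E × E → E) Q P := measurePreserving_fst
  have hsnd : MeasurePreserving (Prod.snd : E × E → E) Q P := measurePreserving_snd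
  set D : ι → E × E → ℝ := fun i p => g i p.1 - g i p.2 with hD
  set ρ : ι → E × E → ℝ := fun i p => R p.1 - R (τ i p).1 with hρ
  set Δ : ι → E × E → ℝ := fun i p => W p.1 - W (τ i p).1 with hΔ
  have hDm : ∀ i, Measurable (D i) := fun i =>
    ((hgm i).comp measurable_fst).sub ((hgm i).comp measurable_snd)
  have hτm : ∀ i, Measurable fun p => (τ i p).1 := fun i => measurable_fst.comp (hτ i).measurable
  have hD2 : ∀ i, MemLp (D i) 2 Q := fun i =>
    ((hg i).comp_measurePreserving hfst).sub ((hg i).comp_measurePreserving hsnd)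
  have hρ2 : ∀ i, MemLp (ρ i) 2 Q := fun i =>
    (hR.comp_measurePreserving hfst).sub (hR.comp_measurePreserving (hfst.comp (hτ i)))
  have hΔ2 : ∀ i, MemLp (Δ i) 2 Q := fun i =>
    (hW2.comp_measurePreserving hfst).sub (hW2.comp_measurePreserving (hfst.comp (hτ i)))
  have hDτ : ∀ i p, D i (τ i p) = -D i p := by
    intro i p
    have h := hgτ i (τ i p)
    rw [hττ] at h
    simp only [hD, hgτ, ← h]
    ring
  have hΔτ : ∀ i p, Δ i (τ i p) = -Δ i p := by
    intro i p
    simp only [hΔ, hττ]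
    ring
  have hΔD : ∀ i p, Δ i p = D i p + ρ i p := by
    intro i p
    have h : ∑ j, g j (τ i p).1 = ∑ j, g j p.1 - D i p := by
      rw [eq_sub_iff_add_eq', ← Finset.add_sum_erase _ _ (Finset.mem_univ i),
        ← Finset.add_sum_erase _ (fun j => g j p.1) (Finset.mem_univ i),
        Finset.sum_congr rfl fun j hj => hgj i j (Finset.ne_of_mem_erase hj) p, hgτ]
      simp only [hD]
      ring
    simp only [hΔ, hW, h, hρ]
    ring
  have hDΔ : ∀ i, Integrable (fun p => D i p * Δ i p) Q := fun i => (hD2 i).integrable_mul (hΔ2 i)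
  have hDρ : ∀ i, Integrable (fun p => D i p * ρ i p) Q := fun i => (hD2 i).integrable_mul (hρ2 i)
  have hDD : ∀ i, Integrable (fun p => D i p * D i p) Q := fun i => (hD2 i).integrable_mul (hD2 i)
  have hD1 : ∀ i, Integrable (D i) Q := fun i => (hD2 i).integrable one_le_two
  have habsDΔ : ∀ i, Integrable (fun p => |D i p| * Δ i p) Q := fun i =>
    (hD2 i).abs.integrable_mul (hΔ2 i)
  have habsDD : ∀ i, Integrable (fun p => |D i p| * D i p) Q := fun i =>
    (hD2 i).abs.integrable_mul (hD2 i)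
  have hbm : ∀ {b : ℝ → ℝ}, Measurable b → Measurable fun p : E × E => b (W p.1) := fun hb =>
    hb.comp (hWm.comp measurable_fst)
  have hbτm : ∀ {b : ℝ → ℝ}, Measurable b → ∀ i, Measurable fun p : E × E => b (W (τ i p).1) :=
    fun hb i => hb.comp (hWm.comp (hτm i))
  have hg1 : ∀ i, Integrable (g i) P := fun i => (hg i).integrable one_le_two
  have hgh : ∀ i, Integrable (fun e => g i e * steinSol z (W e)) P := fun i =>
    integrable_bounded_mul (hg1 i) ((measurable_steinSol z).comp hWm) fun e => abs_steinSol_le z _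
  -- the antisymmetry of `D i` gives the basic identity
  have hbasic : ∀ i, ∫ p, D i p * (steinSol z (W p.1) - steinSol z (W (τ i p).1)) ∂Q
      = 2 * ∫ e, g i e * steinSol z (W e) ∂P := by
    intro i
    have i1 : Integrable (fun p => D i p * steinSol z (W p.1)) Q :=
      integrable_bounded_mul (hD1 i) (hbm (measurable_steinSol z)) fun p => abs_steinSol_le z _
    have i2 : Integrable (fun p => D i p * steinSol z (W (τ i p).1)) Q :=
      integrable_bounded_mul (hD1 i) (hbτm (measurable_steinSol z) i) fun p => abs_steinSol_le z _
    have h0 : ∫ p, D i p * (steinSol z (W p.1) + steinSol z (W (τ i p).1)) ∂Q = 0 := by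
      refine integral_eq_zero_of_comp_eq_neg (hτ i) ?_ fun p => ?_
      · exact ((hDm i).mul ((hbm (measurable_steinSol z)).add
          (hbτm (measurable_steinSol z) i))).aestronglyMeasurable
      · rw [hDτ, hττ]
        ring
    have h1 : ∫ p, D i p * steinSol z (W p.1) ∂Q = ∫ e, g i e * steinSol z (W e) ∂P := by
      have e1 : ∀ p : E × E, D i p * steinSol z (W p.1)
          = g i p.1 * steinSol z (W p.1) - steinSol z (W p.1) * g i p.2 := fun p => by
        simp only [hD]
        ring
      simp_rw [e1]
      rw [integral_sub ((hgh i).comp_fst P) _, integral_prod_mul (fun e => steinSol z (W e)) (g i), hg0, mul_zero, sub_zero,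
        integral_fun_fst (fun e => g i e * steinSol z (W e))]
      · simp
      · exact (integrable_of_abs_le ((measurable_steinSol z).comp hWm)
          fun e => abs_steinSol_le z _).mul_prod (hg1 i)
    simp_rw [mul_add, mul_sub] at h0 ⊢
    rw [integral_add i1 i2] at h0
    rw [integral_sub i1 i2, ← h1]
    linarith
  -- The expansion error carries the weight `|D i| * Δ i`, which is antisymmetric. Against the sum
  -- of the two values of `steinMono` it integrates to zero, so their difference may be replaced by
  -- twice the first value.
  have htaylor : ∀ i, |∫ p, D i p * (steinSol z (W p.1) - steinSol z (W (τ i p).1)) ∂Q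
      - ∫ p, D i p * Δ i p * steinDeriv z (W p.1) ∂Q|
      ≤ 2 * ∫ p, |D i p| * Δ i p * steinMono z (W p.1) ∂Q := by
    intro i
    have i1 : Integrable (fun p => D i p * (steinSol z (W p.1) - steinSol z (W (τ i p).1))) Q := by
      refine integrable_bounded_mul (C := 1.26 + 1.26) (hD1 i)
        ((hbm (measurable_steinSol z)).sub (hbτm (measurable_steinSol z) i)) fun p => ?_
      exact (abs_sub _ _).trans (add_le_add (abs_steinSol_le z _) (abs_steinSol_le z _))
    have i2 : Integrable (fun p => D i p * Δ i p * steinDeriv z (W p.1)) Q :=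
      integrable_bounded_mul (hDΔ i) (hbm (measurable_steinDeriv z)) fun p => abs_steinDeriv_le z _
    have i3 : Integrable (fun p => |D i p| * Δ i p * steinMono z (W p.1)) Q :=
      integrable_bounded_mul (habsDΔ i) (hbm (measurable_steinMono z)) fun p => abs_steinMono_le z _
    have i4 : Integrable (fun p => |D i p| * Δ i p * steinMono z (W (τ i p).1)) Q :=
      integrable_bounded_mul (habsDΔ i) (hbτm (measurable_steinMono z) i)
        fun p => abs_steinMono_le z _
    have h0 : ∫ p, |D i p| * Δ i p * (steinMono z (W p.1) + steinMono z (W (τ i p).1)) ∂Q = 0 := by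
      refine integral_eq_zero_of_comp_eq_neg (hτ i) ?_ fun p => ?_
      · exact (((habsDΔ i).aestronglyMeasurable).mul ((hbm (measurable_steinMono z)).add
          (hbτm (measurable_steinMono z) i)).aestronglyMeasurable)
      · rw [hDτ, hττ, hΔτ, abs_neg]
        ring
    have h1 : 2 * ∫ p, |D i p| * Δ i p * steinMono z (W p.1) ∂Q
        = ∫ p, |D i p| * Δ i p * (steinMono z (W p.1) - steinMono z (W (τ i p).1)) ∂Q := by
      simp_rw [mul_add, mul_sub] at h0 ⊢
      rw [integral_add i3 i4] at h0
      rw [integral_sub i3 i4]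
      linarith
    rw [h1, ← integral_sub i1 i2]
    refine abs_integral_le_integral_abs.trans (integral_mono (i1.sub i2).abs ?_ fun p => ?_)
    · simp_rw [mul_sub]
      exact i3.sub i4
    · have := abs_steinSol_sub_sub_le z (W p.1) (W (τ i p).1)
      have e : D i p * (steinSol z (W p.1) - steinSol z (W (τ i p).1))
          - D i p * Δ i p * steinDeriv z (W p.1) = D i p * (steinSol z (W p.1)
          - steinSol z (W (τ i p).1) - (W p.1 - W (τ i p).1) * steinDeriv z (W p.1)) := by
        simp only [hΔ]
        ring
      show |D i p * (steinSol z (W p.1) - steinSol z (W (τ i p).1))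
          - D i p * Δ i p * steinDeriv z (W p.1)| ≤ _
      rw [e, abs_mul, mul_assoc]
      exact mul_le_mul_of_nonneg_left this (abs_nonneg _)
  -- In `D i * Δ i = D i ^ 2 + D i * ρ i` the second copy is integrated out of the square: the cross
  -- term vanishes as `g i` is centred, and the squared copy becomes its mean.
  have hsq : ∀ i, ∫ p, D i p * Δ i p * steinDeriv z (W p.1) ∂Q
      = ∫ e, (g i e ^ 2 + ∫ e', g i e' ^ 2 ∂P) * steinDeriv z (W e) ∂P
        + ∫ p, D i p * ρ i p * steinDeriv z (W p.1) ∂Q := by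
    intro i
    have m := (measurable_steinDeriv z).comp hWm
    have k1 : Integrable (fun e => steinDeriv z (W e)) P :=
      integrable_of_abs_le m fun e => abs_steinDeriv_le z _
    have k2 : Integrable (fun e => g i e ^ 2 * steinDeriv z (W e)) P :=
      integrable_bounded_mul (hg i).integrable_sq m fun e => abs_steinDeriv_le z _
    have k3 : Integrable (fun e => (-2 * g i e) * steinDeriv z (W e)) P :=
      integrable_bounded_mul ((hg1 i).const_mul _) m fun e => abs_steinDeriv_le z _
    have j1 : Integrable (fun p => D i p * D i p * steinDeriv z (W p.1)) Q :=
      integrable_bounded_mul (hDD i) (hbm (measurable_steinDeriv z)) fun p => abs_steinDeriv_le z _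
    have j2 : Integrable (fun p => D i p * ρ i p * steinDeriv z (W p.1)) Q :=
      integrable_bounded_mul (hDρ i) (hbm (measurable_steinDeriv z)) fun p => abs_steinDeriv_le z _
    have e1 : ∀ p, D i p * Δ i p * steinDeriv z (W p.1) = D i p * D i p * steinDeriv z (W p.1)
        + D i p * ρ i p * steinDeriv z (W p.1) := fun p => by
      rw [hΔD]
      ring
    simp_rw [e1]
    rw [integral_add j1 j2]
    congr 1
    have e2 : ∀ p : E × E, D i p * D i p * steinDeriv z (W p.1)
        = g i p.1 ^ 2 * steinDeriv z (W p.1) + (-2 * g i p.1) * steinDeriv z (W p.1) * g i p.2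
          + steinDeriv z (W p.1) * g i p.2 ^ 2 := fun p => by
      simp only [hD]
      ring
    simp_rw [e2]
    have l1 := k2.comp_fst P
    have l2 := k3.mul_prod (hg1 i)
    have l3 := k1.mul_prod (hg i).integrable_sq
    have l12 : Integrable (fun p : E × E => g i p.1 ^ 2 * steinDeriv z (W p.1)
        + (-2 * g i p.1) * steinDeriv z (W p.1) * g i p.2) Q := l1.add l2
    rw [integral_add l12 l3, integral_add l1 l2,
      integral_fun_fst (fun e => g i e ^ 2 * steinDeriv z (W e)),
      integral_prod_mul (fun e => (-2 * g i e) * steinDeriv z (W e)) (g i),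
      integral_prod_mul (fun e => steinDeriv z (W e)) (fun e => g i e ^ 2), hg0]
    simp_rw [add_mul]
    rw [integral_add k2 (k1.const_mul _), integral_const_mul]
    simp
    ring
  -- Stein's equation
  have hstein : P.real {e | W e ≤ z} - stdCdf z
      = ∫ e, steinDeriv z (W e) ∂P - ∑ i, ∫ e, g i e * steinSol z (W e) ∂P
        - ∫ e, R e * steinSol z (W e) ∂P := by
    have h1 : P.real {e | W e ≤ z} = ∫ e, iicInd z (W e) ∂P := by
      rw [← integral_indicator_one (measurableSet_le hWm measurable_const)]
      rfl
    have i1 : Integrable (fun e => iicInd z (W e)) P :=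
      integrable_of_abs_le (C := 1) ((measurable_iicInd z).comp hWm) fun e => by
        unfold iicInd
        split_ifs <;> norm_num
    have i2 : Integrable (fun e => R e * steinSol z (W e)) P :=
      integrable_bounded_mul (hR.integrable one_le_two) ((measurable_steinSol z).comp hWm)
        fun e => abs_steinSol_le z _
    have i3 : Integrable (fun e => ∑ i, g i e * steinSol z (W e)) P :=
      integrable_finsetSum _ fun i _ => hgh i
    have e1 : ∀ e, steinDeriv z (W e) = ∑ i, g i e * steinSol z (W e) + R e * steinSol z (W e)
        + (iicInd z (W e) - stdCdf z) := fun e => by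
      rw [steinDeriv, ← Finset.sum_mul, ← add_mul]
      ring
    simp_rw [e1]
    have i4 : Integrable (fun e => ∑ i, g i e * steinSol z (W e) + R e * steinSol z (W e)) P :=
      i3.add i2
    have i5 : Integrable (fun e => iicInd z (W e) - stdCdf z) P := i1.sub (integrable_const _)
    rw [integral_add i4 i5, integral_add i3 i2,
      integral_finsetSum _ fun i _ => hgh i, integral_sub i1 (integrable_const _), h1]
    simp
    ring
  have hDρ' : ∀ i, |∫ p, D i p * ρ i p * steinDeriv z (W p.1) ∂Q| ≤ ∫ p, |D i p * ρ i p| ∂Q := by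
    intro i
    refine abs_integral_le_integral_abs.trans (integral_mono ?_ (hDρ i).abs fun p => ?_)
    · exact (integrable_bounded_mul (hDρ i) (hbm (measurable_steinDeriv z))
        fun p => abs_steinDeriv_le z _).abs
    · simp only [abs_mul _ (steinDeriv z _)]
      exact mul_le_of_le_one_right (abs_nonneg _) (abs_steinDeriv_le z _)
  -- Absolute values are taken only after summing over `i`, so that the cancellation among the terms
  -- `|D i| * D i` is kept.
  have hmono : ∑ i, ∫ p, |D i p| * Δ i p * steinMono z (W p.1) ∂Q
      ≤ ∫ p, |∑ i, |D i p| * D i p| ∂Q + ∑ i, ∫ p, |D i p * ρ i p| ∂Q := by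
    have i0 : Integrable (fun p => |∑ i, |D i p| * D i p|) Q :=
      (integrable_finsetSum _ fun i _ => habsDD i).abs
    have i1 : Integrable (fun p => ∑ i, |D i p * ρ i p|) Q :=
      integrable_finsetSum _ fun i _ => (hDρ i).abs
    have i2 : ∀ i, Integrable (fun p => |D i p| * Δ i p * steinMono z (W p.1)) Q := fun i =>
      integrable_bounded_mul (habsDΔ i) (hbm (measurable_steinMono z)) fun p => abs_steinMono_le z _
    rw [← integral_finsetSum _ fun i _ => i2 i, ← integral_finsetSum _ fun i _ => (hDρ i).abs,
      ← integral_add i0 i1]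
    refine integral_mono (integrable_finsetSum _ fun i _ => i2 i) (i0.add i1) fun p => ?_
    have e : ∑ i, |D i p| * Δ i p * steinMono z (W p.1)
        = (∑ i, |D i p| * D i p + ∑ i, |D i p| * ρ i p) * steinMono z (W p.1) := by
      rw [← Finset.sum_add_distrib, Finset.sum_mul]
      exact Finset.sum_congr rfl fun i _ => by rw [hΔD]; ring
    rw [e]
    refine (le_abs_self _).trans ?_
    rw [abs_mul]
    refine (mul_le_of_le_one_right (abs_nonneg _) (abs_steinMono_le z _)).trans ?_
    refine (abs_add_le _ _).trans (add_le_add le_rfl ?_)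
    refine (Finset.abs_sum_le_sum_abs _ _).trans (Finset.sum_le_sum fun i _ => ?_)
    rw [abs_mul, abs_abs, abs_mul]
  -- The interaction terms have weight `1` from the expansion error and `1 / 2` from `hsq`, together
  -- `3 / 2`.
  have hmain : |∑ i, ∫ e, g i e * steinSol z (W e) ∂P
      - (∑ i, ∫ e, (g i e ^ 2 + ∫ e', g i e' ^ 2 ∂P) * steinDeriv z (W e) ∂P) / 2|
      ≤ ∫ p, |∑ i, |D i p| * D i p| ∂Q + 3 / 2 * ∑ i, ∫ p, |D i p * ρ i p| ∂Q := by
    have h1 : ∀ i, |∫ e, g i e * steinSol z (W e) ∂P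
        - (∫ e, (g i e ^ 2 + ∫ e', g i e' ^ 2 ∂P) * steinDeriv z (W e) ∂P) / 2|
        ≤ ∫ p, |D i p| * Δ i p * steinMono z (W p.1) ∂Q + 1 / 2 * ∫ p, |D i p * ρ i p| ∂Q := by
      intro i
      have t := htaylor i
      rw [hbasic, hsq] at t
      have t2 := hDρ' i
      rw [abs_le] at t t2 ⊢
      constructor <;> linarith [t.1, t.2, t2.1, t2.2]
    rw [Finset.sum_div, ← Finset.sum_sub_distrib]
    refine (Finset.abs_sum_le_sum_abs _ _).trans ((Finset.sum_le_sum fun i _ => h1 i).trans ?_)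
    rw [Finset.sum_add_distrib, ← Finset.mul_sum]
    linarith
  have hvar : |∫ e, steinDeriv z (W e) ∂P
      - (∑ i, ∫ e, (g i e ^ 2 + ∫ e', g i e' ^ 2 ∂P) * steinDeriv z (W e) ∂P) / 2|
      ≤ ∫ e, |1 - (∑ i, (g i e ^ 2 + ∫ e', g i e' ^ 2 ∂P)) / 2| ∂P := by
    have m := (measurable_steinDeriv z).comp hWm
    have i0 : ∀ i, Integrable (fun e => g i e ^ 2 + ∫ e', g i e' ^ 2 ∂P) P := fun i =>
      (hg i).integrable_sq.add (integrable_const _)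
    have i1 : ∀ i, Integrable (fun e => (g i e ^ 2 + ∫ e', g i e' ^ 2 ∂P) * steinDeriv z (W e)) P :=
      fun i => integrable_bounded_mul (i0 i) m fun e => abs_steinDeriv_le z _
    have i2 : Integrable (fun e => steinDeriv z (W e)) P :=
      integrable_of_abs_le m fun e => abs_steinDeriv_le z _
    have i3 : Integrable (fun e => 1 - (∑ i, (g i e ^ 2 + ∫ e', g i e' ^ 2 ∂P)) / 2) P :=
      (integrable_const _).sub ((integrable_finsetSum _ fun i _ => i0 i).div_const _)
    rw [← integral_finsetSum _ fun i _ => i1 i, ← integral_div,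
      ← integral_sub i2 ((integrable_finsetSum _ fun i _ => i1 i).div_const _)]
    have e : ∀ e, steinDeriv z (W e)
        - (∑ i, (g i e ^ 2 + ∫ e', g i e' ^ 2 ∂P) * steinDeriv z (W e)) / 2
        = (1 - (∑ i, (g i e ^ 2 + ∫ e', g i e' ^ 2 ∂P)) / 2) * steinDeriv z (W e) := fun e => by
      rw [← Finset.sum_mul]
      ring
    simp_rw [e]
    refine abs_integral_le_integral_abs.trans (integral_mono ?_ i3.abs fun e => ?_)
    · exact (integrable_bounded_mul i3 m fun e => abs_steinDeriv_le z _).abs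
    · simp only [abs_mul _ (steinDeriv z _)]
      exact mul_le_of_le_one_right (abs_nonneg _) (abs_steinDeriv_le z _)
  have hRb : |∫ e, R e * steinSol z (W e) ∂P| ≤ 1.26 * ∫ e, |R e| ∂P := by
    have hR1 := hR.integrable one_le_two
    rw [← integral_const_mul]
    refine abs_integral_le_integral_abs.trans (integral_mono ?_ (hR1.abs.const_mul _) fun e => ?_)
    · exact (integrable_bounded_mul hR1 ((measurable_steinSol z).comp hWm)
        fun e => abs_steinSol_le z _).abs
    · simp only [abs_mul]
      rw [mul_comm]
      exact mul_le_mul_of_nonneg_right (abs_steinSol_le z _) (abs_nonneg _)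
  rw [hstein]
  rw [abs_le] at hmain hvar hRb ⊢
  constructor <;> linarith [hmain.1, hmain.2, hvar.1, hvar.2, hRb.1, hRb.2]

end Swap

/-! ### Random configurations, mixing of two copies, conditional means -/

section ProductSpace

/-- The map `((x, y), (x', y')) ↦ ((x, x'), (y, y'))` preserves product measures. -/
lemma measurePreserving_prodProdProdComm {α β γ δ : Type*} [MeasurableSpace α] [MeasurableSpace β]
    [MeasurableSpace γ] [MeasurableSpace δ] (a : Measure α) (b : Measure β) (c : Measure γ)
    (d : Measure δ) [SFinite a] [SFinite b] [SFinite c] [SFinite d] :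
    MeasurePreserving (fun p : (α × β) × γ × δ => ((p.1.1, p.2.1), (p.1.2, p.2.2)))
      ((a.prod b).prod (c.prod d)) ((a.prod c).prod (b.prod d)) := by
  have h1 := measurePreserving_prodAssoc a b (c.prod d)
  have h2 : MeasurePreserving (fun p : β × γ × δ => (p.2.1, p.1, p.2.2))
      (b.prod (c.prod d)) (c.prod (b.prod d)) :=
    (measurePreserving_prodAssoc c b d).comp
      (((Measure.measurePreserving_swap (μ := b) (ν := c)).prod (MeasurePreserving.id d)).comp
        ((measurePreserving_prodAssoc b c d).symm))
  exact ((measurePreserving_prodAssoc a c (b.prod d)).symm).comp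
    (((MeasurePreserving.id a).prod h2).comp h1)

/-- Swapping the coordinates outside `A` between two independent copies preserves the measure. -/
lemma measurePreserving_piecewise_swap {ι 𝒳 : Type*} [Fintype ι] [DecidableEq ι]
    [MeasurableSpace 𝒳] (μ : Measure 𝒳) [IsProbabilityMeasure μ] (A : Finset ι) :
    MeasurePreserving (fun p : (ι → 𝒳) × (ι → 𝒳) => (A.piecewise p.1 p.2, A.piecewise p.2 p.1))
      ((Measure.pi fun _ => μ).prod (Measure.pi fun _ => μ))
      ((Measure.pi fun _ => μ).prod (Measure.pi fun _ => μ)) := by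
  have h := measurePreserving_arrowProdEquivProdArrow 𝒳 𝒳 ι (fun _ => μ) (fun _ => μ)
  have h2 := measurePreserving_pi (fun _ : ι => μ.prod μ) (fun _ : ι => μ.prod μ)
    (f := fun j => if j ∈ A then id else Prod.swap) fun j => by
      split_ifs
      · exact MeasurePreserving.id _
      · exact Measure.measurePreserving_swap
  convert h.comp (h2.comp h.symm) using 1
  funext p
  refine Prod.ext (funext fun j => ?_) (funext fun j => ?_) <;>
  · by_cases hj : j ∈ A <;>
    simp [hj, MeasurableEquiv.arrowProdEquivProdArrow, Equiv.arrowProdEquivProdArrow, Finset.piecewise]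

/-- The space of values of `n` points and of the labels of all pairs of them. -/
abbrev Config (𝒳 𝒴 : Type*) (n : ℕ) : Type _ := (Fin n → 𝒳) × (Edge n → 𝒴)

variable {𝒳 𝒴 : Type*} {k n : ℕ}

namespace Config

/-- The configuration induced by an injective map of indices. -/
def restrict (α : Fin k ↪ Fin n) (e : Config 𝒳 𝒴 n) : Config 𝒳 𝒴 k :=
  (fun i => e.1 (α i), fun j => e.2 (j.map α))

/-- Replace the `i`-th point of a configuration. -/
def update (e : Config 𝒳 𝒴 n) (i : Fin n) (t : 𝒳) : Config 𝒳 𝒴 n := (Function.update e.1 i t, e.2)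

/-- Take the points in `A` and the labels in `B` from the first of two configurations, and the
others from the second one. -/
def mix (A : Finset (Fin n)) (B : Finset (Edge n)) (p : Config 𝒳 𝒴 n × Config 𝒳 𝒴 n) :
    Config 𝒳 𝒴 n :=
  (A.piecewise p.1.1 p.2.1, B.piecewise p.1.2 p.2.2)

/-- Swap the points outside `A` and the labels outside `B` between two configurations. -/
def exchange (A : Finset (Fin n)) (B : Finset (Edge n)) (p : Config 𝒳 𝒴 n × Config 𝒳 𝒴 n) :
    Config 𝒳 𝒴 n × Config 𝒳 𝒴 n :=
  (mix A B p, mix A B p.swap)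

lemma exchange_exchange (A : Finset (Fin n)) (B : Finset (Edge n))
    (p : Config 𝒳 𝒴 n × Config 𝒳 𝒴 n) : exchange A B (exchange A B p) = p := by
  refine Prod.ext (Prod.ext (funext fun j => ?_) (funext fun j => ?_))
    (Prod.ext (funext fun j => ?_) (funext fun j => ?_)) <;>
  · simp only [exchange, mix, Finset.piecewise, Prod.fst_swap, Prod.snd_swap]
    split_ifs <;> rfl

lemma mix_singleton_empty (i : Fin n) (p : Config 𝒳 𝒴 n × Config 𝒳 𝒴 n) :
    mix {i} ∅ p = p.2.update i (p.1.1 i) := by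
  simp [mix, update, Finset.piecewise_singleton]

lemma update_restrict (α : Fin k ↪ Fin n) (e : Config 𝒳 𝒴 n) (p : Fin k) (t : 𝒳) :
    (e.update (α p) t).restrict α = (e.restrict α).update p t := by
  refine Prod.ext (funext fun j => ?_) rfl
  by_cases hj : j = p
  · subst hj
    simp [restrict, update]
  · simp [restrict, update, hj]

lemma update_restrict_of_notMem (α : Fin k ↪ Fin n) (e : Config 𝒳 𝒴 n) {i : Fin n}
    (hi : i ∉ Set.range α) (t : 𝒳) : (e.update i t).restrict α = e.restrict α := by
  refine Prod.ext (funext fun j => ?_) rfl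
  have : α j ≠ i := fun h => hi ⟨j, h⟩
  simp [restrict, update, this]

/-- The set of the pairs contained in the range of `α`. -/
def edges (α : Fin k ↪ Fin n) : Finset (Edge n) := Finset.univ.image (Edge.map α)

/-- The range of `α`. -/
def verts (α : Fin k ↪ Fin n) : Finset (Fin n) := Finset.univ.map α

lemma mem_verts {α : Fin k ↪ Fin n} {i : Fin n} : i ∈ verts α ↔ i ∈ Set.range α := by
  simp [verts]

lemma card_verts (α : Fin k ↪ Fin n) : (verts α).card = k := by simp [verts]

lemma mem_verts_of_mem_edges {α : Fin k ↪ Fin n} {e : Edge n} (he : e ∈ edges α) {i : Fin n}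
    (hi : i ∈ e.1) : i ∈ verts α := by
  simp only [edges, Finset.mem_image, Finset.mem_univ, true_and] at he
  obtain ⟨f, rfl⟩ := he
  obtain ⟨j, -, rfl⟩ := Sym2.mem_map.1 hi
  simp [verts]

lemma restrict_mix_of_subset {α : Fin k ↪ Fin n} {A : Finset (Fin n)} {B : Finset (Edge n)}
    (hA : verts α ⊆ A) (hB : edges α ⊆ B) (p : Config 𝒳 𝒴 n × Config 𝒳 𝒴 n) :
    (mix A B p).restrict α = p.1.restrict α := by
  refine Prod.ext (funext fun j => ?_) (funext fun e => ?_)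
  · exact Finset.piecewise_eq_of_mem _ _ _ (hA (mem_verts.2 ⟨j, rfl⟩))
  · exact Finset.piecewise_eq_of_mem B _ _
      (hB (Finset.mem_image_of_mem (Edge.map α) (Finset.mem_univ e)))

/-- Two index maps whose ranges have at most one common point have no common pairs. -/
lemma restrict_mix_of_inter_subset {α β : Fin k ↪ Fin n} {i : Fin n}
    (h : verts α ∩ verts β ⊆ {i}) (p : Config 𝒳 𝒴 n × Config 𝒳 𝒴 n) :
    (mix (insert i (verts α)) (edges α) p).restrict β
      = (p.2.update i (p.1.1 i)).restrict β := by
  refine Prod.ext (funext fun j => ?_) (funext fun e => ?_)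
  · simp only [restrict, mix, update]
    by_cases hj : β j = i
    · rw [hj, Function.update_self, Finset.piecewise_insert_self]
    · rw [Function.update_of_ne hj, Finset.piecewise_eq_of_notMem]
      rw [Finset.mem_insert, not_or]
      refine ⟨hj, fun hα => hj ?_⟩
      exact Finset.mem_singleton.1 (h (Finset.mem_inter.2 ⟨hα, mem_verts.2 ⟨j, rfl⟩⟩))
  · simp only [restrict, mix, update]
    rw [Finset.piecewise_eq_of_notMem]
    intro he
    have hβ : e.map β ∈ edges β := Finset.mem_image_of_mem (Edge.map β) (Finset.mem_univ e)
    -- A pair in both edge sets has both ends in the intersection of the ranges, so both equal `i`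
    -- and the pair would be diagonal.
    generalize e.map β = e' at he hβ
    obtain ⟨s, hs⟩ := e'
    induction s with
    | _ a b =>
      have ha : a = i := Finset.mem_singleton.1 (h (Finset.mem_inter.2
        ⟨mem_verts_of_mem_edges he (Sym2.mem_mk_left a b),
          mem_verts_of_mem_edges hβ (Sym2.mem_mk_left a b)⟩))
      have hb : b = i := Finset.mem_singleton.1 (h (Finset.mem_inter.2
        ⟨mem_verts_of_mem_edges he (Sym2.mem_mk_right a b),
          mem_verts_of_mem_edges hβ (Sym2.mem_mk_right a b)⟩))
      exact hs (by rw [ha, hb]; simp)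

end Config

variable [MeasurableSpace 𝒳] [MeasurableSpace 𝒴]

/-- The law of a configuration of independent points and labels. -/
noncomputable abbrev configMeasure (μ : Measure 𝒳) (ν : Measure 𝒴) (n : ℕ) :
    Measure (Config 𝒳 𝒴 n) :=
  (Measure.pi fun _ => μ).prod (Measure.pi fun _ => ν)

lemma measurable_update (i : Fin n) :
    Measurable fun p : 𝒳 × Config 𝒳 𝒴 n => p.2.update i p.1 := by
  unfold Config.update
  refine Measurable.prodMk (measurable_pi_lambda _ fun j => ?_) (by fun_prop)
  by_cases hj : j = i
  · subst hj
    simp only [Function.update_self]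
    fun_prop
  · simp only [Function.update_of_ne hj]
    fun_prop

variable (μ : Measure 𝒳) (ν : Measure 𝒴) [IsProbabilityMeasure μ] [IsProbabilityMeasure ν]

open Config

lemma measurePreserving_exchange (A : Finset (Fin n)) (B : Finset (Edge n)) :
    MeasurePreserving (exchange A B : Config 𝒳 𝒴 n × Config 𝒳 𝒴 n → _)
      ((configMeasure μ ν n).prod (configMeasure μ ν n))
      ((configMeasure μ ν n).prod (configMeasure μ ν n)) :=
  (measurePreserving_prodProdProdComm _ _ _ _).comp
    (((measurePreserving_piecewise_swap μ A).prod (measurePreserving_piecewise_swap ν B)).comp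
      (measurePreserving_prodProdProdComm _ _ _ _))

lemma measurePreserving_mix (A : Finset (Fin n)) (B : Finset (Edge n)) :
    MeasurePreserving (mix A B : Config 𝒳 𝒴 n × Config 𝒳 𝒴 n → _)
      ((configMeasure μ ν n).prod (configMeasure μ ν n)) (configMeasure μ ν n) :=
  measurePreserving_fst.comp (measurePreserving_exchange μ ν A B)

lemma measurePreserving_pi_comp {ι κ : Type*} [Fintype ι] [Fintype κ] {α : κ → ι}
    (hα : Function.Injective α) :
    MeasurePreserving (fun (x : ι → 𝒳) i => x (α i)) (Measure.pi fun _ => μ)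
      (Measure.pi fun _ => μ) where
  measurable := by fun_prop
  map_eq := by
    rw [← Measure.infinitePi_eq_pi, ← Measure.infinitePi_eq_pi]
    exact Measure.map_infinitePi_infinitePi_of_inj (P := fun _ => μ) hα

lemma _root_.GenUStat.Edge.map_injective (α : Fin k ↪ Fin n) : Function.Injective (Edge.map α) :=
  fun _ _ h => Subtype.ext (Sym2.map.injective α.injective (Subtype.ext_iff.1 h))

lemma measurePreserving_restrict (α : Fin k ↪ Fin n) :
    MeasurePreserving (restrict α : Config 𝒳 𝒴 n → _) (configMeasure μ ν n)
      (configMeasure μ ν k) :=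
  (measurePreserving_pi_comp μ α.injective).prod (measurePreserving_pi_comp ν (Edge.map_injective α))

lemma measurePreserving_point (i : Fin n) :
    MeasurePreserving (fun e : Config 𝒳 𝒴 n => e.1 i) (configMeasure μ ν n) μ :=
  (measurePreserving_eval (fun _ => μ) i).comp measurePreserving_fst

/-- The conditional mean of `F` given that the `i`-th point is `t`. -/
noncomputable def condMean (F : Config 𝒳 𝒴 n → ℝ) (i : Fin n) (t : 𝒳) : ℝ :=
  ∫ e, F (e.update i t) ∂configMeasure μ ν n

variable {F u : Config 𝒳 𝒴 n → ℝ}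

lemma measurable_condMean (hF : Measurable F) (i : Fin n) : Measurable (condMean μ ν F i) :=
  ((hF.comp (measurable_update i)).stronglyMeasurable.integral_prod_right').measurable

/-- A function of the points in `A` and the labels in `B` is integrated against a function that,
given these, depends on them through the `i`-th point only. -/
lemma integral_mul_eq_integral_mul_condMean (hF : Measurable F) (hu : Measurable u)
    (huF : Integrable (fun e => u e * F e) (configMeasure μ ν n)) (A : Finset (Fin n))
    (B : Finset (Edge n)) (i : Fin n) (h1 : ∀ p, u (mix A B p) = u p.1)
    (h2 : ∀ p, F (mix A B p) = F (p.2.update i (p.1.1 i))) :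
    ∫ e, u e * F e ∂configMeasure μ ν n
      = ∫ e, u e * condMean μ ν F i (e.1 i) ∂configMeasure μ ν n := by
  have h := measurePreserving_mix μ ν A B
  have hi := h.integrable_comp_of_integrable huF
  -- A mixture of two independent copies has the law of one. There `u` sees only the first copy, and
  -- `F` only the second with one point replaced, so integrating over the second copy produces
  -- `condMean`.
  rw [← integral_comp_eq h (u := fun e => u e * F e) (hu.mul hF).aestronglyMeasurable]
  simp only [Function.comp_def, h1, h2] at hi ⊢
  rw [integral_prod _ hi]
  simp_rw [integral_const_mul]
  rfl

end ProductSpace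

/-! ### Degenerate kernels and the remainder of the first projection -/

section Kernel

open Config

lemma restrict_refl {𝒳 𝒴 : Type*} {n : ℕ} (e : Config 𝒳 𝒴 n) : restrict (Function.Embedding.refl _) e = e :=
  Prod.ext rfl (funext fun j => by simp [restrict, Edge.map])

variable {𝒳 𝒴 : Type*} {k n : ℕ} [MeasurableSpace 𝒳] [MeasurableSpace 𝒴]
  (μ : Measure 𝒳) (ν : Measure 𝒴) [IsProbabilityMeasure μ] [IsProbabilityMeasure ν]
  {F G : Config 𝒳 𝒴 k → ℝ}

lemma measurable_restrict (α : Fin k ↪ Fin n) :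
    Measurable (restrict α : Config 𝒳 𝒴 n → Config 𝒳 𝒴 k) := by
  unfold restrict
  fun_prop

lemma measurable_update_left (i : Fin n) (t : 𝒳) :
    Measurable fun e : Config 𝒳 𝒴 n => e.update i t :=
  (measurable_update i).comp measurable_prodMk_left

/-- Resampling a single point is `mix {i} ∅`, with the first copy reduced to its `i`-th point. -/
lemma measurePreserving_update (i : Fin n) :
    MeasurePreserving (fun p : 𝒳 × Config 𝒳 𝒴 n => p.2.update i p.1)
      (μ.prod (configMeasure μ ν n)) (configMeasure μ ν n) where
  measurable := measurable_update i
  map_eq := by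
    have h1 := (measurePreserving_point μ ν i).prod (MeasurePreserving.id (configMeasure μ ν n))
    have h2 := measurePreserving_mix μ ν {i} (∅ : Finset (Edge n))
    rw [← h1.map_eq, Measure.map_map (measurable_update i) h1.measurable]
    convert h2.map_eq using 2
    funext p
    exact (mix_singleton_empty i p).symm

lemma integrable_update_ae (hF : Integrable F (configMeasure μ ν k)) (p : Fin k) :
    ∀ᵐ t ∂μ, Integrable (fun e => F (e.update p t)) (configMeasure μ ν k) :=
  ((measurePreserving_update μ ν p).integrable_comp_of_integrable hF).prod_right_ae

lemma integrable_condMean (hF : Integrable F (configMeasure μ ν k)) (p : Fin k) :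
    Integrable (condMean μ ν F p) μ :=
  ((measurePreserving_update μ ν p).integrable_comp_of_integrable hF).integral_prod_left

lemma integral_condMean (hF : Integrable F (configMeasure μ ν k)) (p : Fin k) :
    ∫ t, condMean μ ν F p t ∂μ = ∫ e, F e ∂configMeasure μ ν k := by
  have h := measurePreserving_update μ ν p
  rw [← integral_comp_eq h hF.1]
  exact (integral_prod _ (h.integrable_comp_of_integrable hF)).symm

lemma condMean_restrict (hF : Measurable F) (α : Fin k ↪ Fin n) (p : Fin k) (t : 𝒳) :
    condMean μ ν (fun e => F (restrict α e)) (α p) t = condMean μ ν F p t := by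
  simp only [condMean, update_restrict]
  exact integral_comp_eq (measurePreserving_restrict μ ν α)
    (hF.comp (measurable_update_left p t)).aestronglyMeasurable

lemma condMean_restrict_of_notMem (hF : Measurable F) (α : Fin k ↪ Fin n) {i : Fin n}
    (hi : i ∉ Set.range α) (t : 𝒳) :
    condMean μ ν (fun e => F (restrict α e)) i t = ∫ e, F e ∂configMeasure μ ν k := by
  simp only [condMean, update_restrict_of_notMem α _ hi]
  exact integral_comp_eq (measurePreserving_restrict μ ν α) hF.aestronglyMeasurable

/-- The variance of the slice with `p`-th point `t` is nonnegative (Jensen). Square integrability of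
the slice is available only for almost every `t`. -/
lemma condMean_sq_le (hF : Measurable F) (hF2 : Integrable (fun e => F e ^ 2) (configMeasure μ ν k))
    (p : Fin k) : ∀ᵐ t ∂μ, condMean μ ν F p t ^ 2 ≤ condMean μ ν (fun e => F e ^ 2) p t := by
  filter_upwards [integrable_update_ae μ ν hF2 p] with t ht
  have hm := (hF.comp (measurable_update_left p t)).aestronglyMeasurable
    (μ := configMeasure μ ν k)
  have h2 : MemLp (fun e => F (e.update p t)) 2 (configMeasure μ ν k) :=
    (memLp_two_iff_integrable_sq hm).2 ht
  have h := variance_nonneg (fun e => F (e.update p t)) (configMeasure μ ν k)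
  rw [variance_eq_sub h2] at h
  simpa [condMean] using h

lemma memLp_condMean (hF : Measurable F) (hF2 : MemLp F 2 (configMeasure μ ν k)) (p : Fin k) :
    MemLp (condMean μ ν F p) 2 μ := by
  have hm := measurable_condMean μ ν hF p
  refine (memLp_two_iff_integrable_sq hm.aestronglyMeasurable).2 ?_
  refine (integrable_condMean μ ν hF2.integrable_sq p).mono'
    (hm.pow_const 2).aestronglyMeasurable ?_
  filter_upwards [condMean_sq_le μ ν hF hF2.integrable_sq p] with t ht
  rwa [Real.norm_of_nonneg (sq_nonneg _)]

/-- Jensen's inequality twice, for `F` and for `F ^ 2`. -/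
lemma condMean_pow_four_le (hF : Measurable F)
    (hF4 : Integrable (fun e => F e ^ 4) (configMeasure μ ν k)) (p : Fin k) :
    Integrable (fun t => condMean μ ν F p t ^ 4) μ ∧
      ∫ t, condMean μ ν F p t ^ 4 ∂μ ≤ ∫ e, F e ^ 4 ∂configMeasure μ ν k := by
  have e4 : (fun e => (F e ^ 2) ^ 2) = fun e => F e ^ 4 := funext fun e => by ring
  have hF2 : Integrable (fun e => F e ^ 2) (configMeasure μ ν k) := by
    have : MemLp (fun e => F e ^ 2) 2 (configMeasure μ ν k) :=
      (memLp_two_iff_integrable_sq (hF.pow_const 2).aestronglyMeasurable).2 (by rwa [e4])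
    exact this.integrable one_le_two
  have h2 := condMean_sq_le μ ν (hF.pow_const 2) (by rwa [e4]) p
  rw [e4] at h2
  have hle : ∀ᵐ t ∂μ, condMean μ ν F p t ^ 4 ≤ condMean μ ν (fun e => F e ^ 4) p t := by
    filter_upwards [condMean_sq_le μ ν hF hF2 p, h2] with t h1 h2
    refine le_trans ?_ h2
    have : condMean μ ν F p t ^ 4 = (condMean μ ν F p t ^ 2) ^ 2 := by ring
    rw [this]
    exact pow_le_pow_left₀ (sq_nonneg _) h1 2
  have hi := integrable_condMean μ ν hF4 p
  have hi4 : Integrable (fun t => condMean μ ν F p t ^ 4) μ := by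
    refine hi.mono' ((measurable_condMean μ ν hF p).pow_const 4).aestronglyMeasurable ?_
    filter_upwards [hle] with t ht
    rwa [Real.norm_of_nonneg (by positivity)]
  refine ⟨hi4, ?_⟩
  rw [← integral_condMean μ ν hF4 p]
  exact integral_mono_ae hi4 hi hle

/-- A kernel is degenerate if its conditional mean given any one of the points vanishes. -/
def IsDegenerate (F : Config 𝒳 𝒴 k → ℝ) : Prop := ∀ p, ∀ᵐ t ∂μ, condMean μ ν F p t = 0

variable {μ ν}

lemma IsDegenerate.integral_eq_zero (hk : 1 ≤ k) (h : IsDegenerate μ ν F)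
    (hF : Integrable F (configMeasure μ ν k)) : ∫ e, F e ∂configMeasure μ ν k = 0 := by
  rw [← integral_condMean μ ν hF ⟨0, hk⟩]
  exact integral_eq_zero_of_ae (h _)

/-- If the range of `α` omits `i`, the conditional mean is the full mean, which vanishes too. -/
lemma IsDegenerate.condMean_restrict_eq_zero (hk : 1 ≤ k) (h : IsDegenerate μ ν F)
    (hFm : Measurable F) (hF : Integrable F (configMeasure μ ν k)) (α : Fin k ↪ Fin n) (i : Fin n) :
    ∀ᵐ e ∂configMeasure μ ν n, condMean μ ν (fun e => F (restrict α e)) i (e.1 i) = 0 := by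
  refine (measurePreserving_point μ ν i).quasiMeasurePreserving.ae
    (p := fun t => condMean μ ν (fun e => F (restrict α e)) i t = 0) ?_
  by_cases hi : i ∈ Set.range α
  · obtain ⟨p, rfl⟩ := hi
    filter_upwards [h p] with t ht
    rw [condMean_restrict μ ν hFm, ht]
  · refine Filter.Eventually.of_forall fun t => ?_
    rw [condMean_restrict_of_notMem μ ν hFm α hi, h.integral_eq_zero hk hF]

lemma memLp_restrict {q : ℝ≥0∞} (hF : MemLp F q (configMeasure μ ν k)) (α : Fin k ↪ Fin n) :
    MemLp (fun e => F (restrict α e)) q (configMeasure μ ν n) :=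
  hF.comp_measurePreserving (measurePreserving_restrict μ ν α)

lemma memLp_point {q : ℝ≥0∞} {φ : 𝒳 → ℝ} (hφ : MemLp φ q μ) (i : Fin n) :
    MemLp (fun e : Config 𝒳 𝒴 n => φ (e.1 i)) q (configMeasure μ ν n) :=
  hφ.comp_measurePreserving (measurePreserving_point μ ν i)

/-- A common label would require two common indices. So, given the only possible common point, the
two kernels are independent, and the second has conditional mean zero. -/
lemma IsDegenerate.integral_mul_eq_zero (hk : 1 ≤ k) (h : IsDegenerate μ ν F) (hFm : Measurable F)
    (hF : MemLp F 2 (configMeasure μ ν k)) {α β : Fin k ↪ Fin n}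
    (hαβ : (verts α ∩ verts β).card ≤ 1) :
    ∫ e, F (restrict α e) * F (restrict β e) ∂configMeasure μ ν n = 0 := by
  -- This provides an index `i` even when the ranges are disjoint.
  have : Nonempty (Fin n) := ⟨α ⟨0, hk⟩⟩
  obtain ⟨i, hi⟩ := Finset.card_le_one_iff_subset_singleton.1 hαβ
  rw [integral_mul_eq_integral_mul_condMean μ ν (u := fun e => F (restrict α e))
    (F := fun e => F (restrict β e)) (hFm.comp (measurable_restrict β))
    (hFm.comp (measurable_restrict α)) ((memLp_restrict hF α).integrable_mul (memLp_restrict hF β))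
    (insert i (verts α)) (edges α) i
    (fun p => by rw [restrict_mix_of_subset (Finset.subset_insert _ _) subset_rfl])
    (fun p => by simp only [restrict_mix_of_inter_subset hi])]
  refine integral_eq_zero_of_ae ?_
  filter_upwards [h.condMean_restrict_eq_zero hk hFm (hF.integrable one_le_two) β i] with e he
  simp only [he, mul_zero, Pi.zero_apply]

/-- Conditioning on the `i`-th point annihilates the kernel, whether or not `α` hits `i`. This makes
the linear and the degenerate parts orthogonal. -/
lemma IsDegenerate.integral_point_mul_eq_zero (hk : 1 ≤ k) (h : IsDegenerate μ ν F)
    (hFm : Measurable F) (hF : MemLp F 2 (configMeasure μ ν k)) {φ : 𝒳 → ℝ} (hφm : Measurable φ)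
    (hφ : MemLp φ 2 μ) (α : Fin k ↪ Fin n) (i : Fin n) :
    ∫ e, φ (e.1 i) * F (restrict α e) ∂configMeasure μ ν n = 0 := by
  rw [integral_mul_eq_integral_mul_condMean μ ν (u := fun e => φ (e.1 i))
    (F := fun e => F (restrict α e))
    (hFm.comp (measurable_restrict α)) (hφm.comp (by fun_prop))
    ((memLp_point hφ i).integrable_mul (memLp_restrict hF α)) {i} ∅ i
    (fun p => by simp [mix]) (fun p => by rw [mix_singleton_empty])]
  refine integral_eq_zero_of_ae ?_
  filter_upwards [h.condMean_restrict_eq_zero hk hFm (hF.integrable one_le_two) α i] with e he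
  simp only [he, mul_zero, Pi.zero_apply]

/-- In the second moment of a sum of degenerate kernels, only pairs of index maps whose ranges have
at least two common points contribute. -/
lemma IsDegenerate.integral_sum_sq_le (hk : 1 ≤ k) (h : IsDegenerate μ ν F) (hFm : Measurable F)
    (hF : MemLp F 2 (configMeasure μ ν k)) (𝒜 : Finset (Fin k ↪ Fin n)) :
    ∫ e, (∑ α ∈ 𝒜, F (restrict α e)) ^ 2 ∂configMeasure μ ν n
      ≤ (∑ α ∈ 𝒜, ∑ β ∈ 𝒜, if 2 ≤ (verts α ∩ verts β).card then 1 else 0)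
        * ∫ e, F e ^ 2 ∂configMeasure μ ν k := by
  have hint : ∀ α β : Fin k ↪ Fin n,
      Integrable (fun e => F (restrict α e) * F (restrict β e)) (configMeasure μ ν n) :=
    fun α β => (memLp_restrict hF α).integrable_mul (memLp_restrict hF β)
  have hsq : ∀ α : Fin k ↪ Fin n, ∫ e, F (restrict α e) ^ 2 ∂configMeasure μ ν n
      = ∫ e, F e ^ 2 ∂configMeasure μ ν k := fun α =>
    integral_comp_eq (u := fun e => F e ^ 2) (measurePreserving_restrict μ ν α)
      (hFm.pow_const 2).aestronglyMeasurable
  simp_rw [sq (∑ α ∈ 𝒜, _), Finset.sum_mul_sum]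
  rw [integral_finsetSum _ fun α _ => integrable_finsetSum _ fun β _ => hint α β, Finset.sum_mul]
  refine Finset.sum_le_sum fun α _ => ?_
  rw [integral_finsetSum _ fun β _ => hint α β, Finset.sum_mul]
  refine Finset.sum_le_sum fun β _ => ?_
  split_ifs with h2
  · have i1 := (memLp_restrict hF α).integrable_sq
    have i2 := (memLp_restrict hF β).integrable_sq
    -- Since `2ab ≤ a² + b²` and all restrictions have the same law, a pair costs at most one second
    -- moment.
    have : ∫ e, F (restrict α e) * F (restrict β e) ∂configMeasure μ ν n
        ≤ ∫ e, (F (restrict α e) ^ 2 + F (restrict β e) ^ 2) / 2 ∂configMeasure μ ν n := by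
      refine integral_mono (hint α β) ((i1.add i2).div_const 2) fun e => ?_
      simp only
      nlinarith [sq_nonneg (F (restrict α e) - F (restrict β e))]
    rw [integral_div, integral_add i1 i2, hsq, hsq] at this
    linarith
  · rw [h.integral_mul_eq_zero hk hFm hF (by lia)]
    simp

variable (μ ν)

/-- The first projection of a kernel: its centred conditional mean given the first point. -/
noncomputable def proj (hk : 1 ≤ k) (F : Config 𝒳 𝒴 k → ℝ) (t : 𝒳) : ℝ :=
  condMean μ ν F ⟨0, hk⟩ t - ∫ e, F e ∂configMeasure μ ν k

/-- What remains of a kernel after subtracting its mean and its first projections. -/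
noncomputable def remainder (hk : 1 ≤ k) (F : Config 𝒳 𝒴 k → ℝ) (e : Config 𝒳 𝒴 k) : ℝ :=
  F e - ∫ e, F e ∂configMeasure μ ν k - ∑ p, proj μ ν hk F (e.1 p)

variable (hk : 1 ≤ k)

lemma measurable_proj (hF : Measurable F) : Measurable (proj μ ν hk F) :=
  (measurable_condMean μ ν hF _).sub_const _

lemma memLp_proj (hF : Measurable F) (hF2 : MemLp F 2 (configMeasure μ ν k)) :
    MemLp (proj μ ν hk F) 2 μ :=
  (memLp_condMean μ ν hF hF2 _).sub (memLp_const _)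

lemma integral_proj (hF : Integrable F (configMeasure μ ν k)) : ∫ t, proj μ ν hk F t ∂μ = 0 := by
  simp only [proj]
  rw [integral_sub (integrable_condMean μ ν hF _) (integrable_const _), integral_condMean μ ν hF]
  simp

lemma measurable_remainder (hF : Measurable F) : Measurable (remainder μ ν hk F) :=
  (hF.sub_const _).sub (Finset.measurable_sum _ fun p _ =>
    (measurable_proj μ ν hk hF).comp (by fun_prop))

lemma memLp_remainder (hF : Measurable F) (hF2 : MemLp F 2 (configMeasure μ ν k)) :
    MemLp (remainder μ ν hk F) 2 (configMeasure μ ν k) :=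
  (hF2.sub (memLp_const _)).sub (memLp_finsetSum _ fun p _ =>
    memLp_point (memLp_proj μ ν hk hF hF2) p)

lemma condMean_eq_of_symmetric (hF : Measurable F)
    (hsymm : ∀ π : Equiv.Perm (Fin k), ∀ e, F (restrict π.toEmbedding e) = F e) (p q : Fin k)
    (t : 𝒳) : condMean μ ν F p t = condMean μ ν F q t := by
  have h := condMean_restrict μ ν hF (Equiv.swap p q).toEmbedding p t
  simp only [hsymm] at h
  rw [← h]
  simp

/-- With the `p`-th point fixed, the projections at the other points average to zero and the one at
`p` cancels the centred conditional mean of `F`. Symmetry is needed because `proj` is defined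
through the first point only. -/
lemma isDegenerate_remainder (hF : Measurable F) (hF2 : MemLp F 2 (configMeasure μ ν k))
    (hsymm : ∀ π : Equiv.Perm (Fin k), ∀ e, F (restrict π.toEmbedding e) = F e) :
    IsDegenerate μ ν (remainder μ ν hk F) := by
  intro p
  have hF1 := hF2.integrable one_le_two
  have hφ := (memLp_proj μ ν hk hF hF2).integrable one_le_two
  filter_upwards [integrable_update_ae μ ν hF1 p] with t ht
  have hsum : ∀ e : Config 𝒳 𝒴 k, ∑ q, proj μ ν hk F ((e.update p t).1 q)
      = proj μ ν hk F t + ∑ q ∈ Finset.univ.erase p, proj μ ν hk F (e.1 q) := by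
    intro e
    rw [← Finset.add_sum_erase _ _ (Finset.mem_univ p)]
    congr 1
    · simp [Config.update]
    · refine Finset.sum_congr rfl fun q hq => ?_
      simp [Config.update, Finset.ne_of_mem_erase hq]
  have hi : ∀ q : Fin k, Integrable (fun e : Config 𝒳 𝒴 k => proj μ ν hk F (e.1 q))
      (configMeasure μ ν k) := fun q =>
    (measurePreserving_point μ ν q).integrable_comp_of_integrable hφ
  have h0 : ∀ q : Fin k, ∫ e : Config 𝒳 𝒴 k, proj μ ν hk F (e.1 q) ∂configMeasure μ ν k = 0 :=
    fun q => by
      rw [integral_comp_eq (measurePreserving_point μ ν q) hφ.1, integral_proj μ ν hk hF1]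
  have is : Integrable (fun e : Config 𝒳 𝒴 k =>
      ∑ q ∈ Finset.univ.erase p, proj μ ν hk F (e.1 q)) (configMeasure μ ν k) :=
    integrable_finsetSum _ fun q _ => hi q
  have i1 : Integrable (fun e : Config 𝒳 𝒴 k => F (e.update p t) - ∫ e, F e ∂configMeasure μ ν k)
      (configMeasure μ ν k) := ht.sub (integrable_const _)
  have i2 : Integrable (fun e : Config 𝒳 𝒴 k => proj μ ν hk F t
      + ∑ q ∈ Finset.univ.erase p, proj μ ν hk F (e.1 q)) (configMeasure μ ν k) :=
    (integrable_const _).add is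
  simp only [condMean, remainder, hsum]
  rw [integral_sub i1 i2, integral_sub ht (integrable_const _), integral_add (integrable_const _) is,
    integral_finsetSum _ fun q _ => hi q, Finset.sum_eq_zero fun q _ => h0 q]
  have : ∫ e, F (e.update p t) ∂configMeasure μ ν k = condMean μ ν F ⟨0, hk⟩ t :=
    condMean_eq_of_symmetric μ ν hF hsymm p _ t
  rw [this]
  simp [proj]

/-- Pythagoras: the remainder is orthogonal to the projections, so its second moment is at most the
variance of `F`. -/
lemma integral_remainder_sq_le (hF : Measurable F) (hF2 : MemLp F 2 (configMeasure μ ν k))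
    (hsymm : ∀ π : Equiv.Perm (Fin k), ∀ e, F (restrict π.toEmbedding e) = F e) :
    ∫ e, remainder μ ν hk F e ^ 2 ∂configMeasure μ ν k ≤ ∫ e, F e ^ 2 ∂configMeasure μ ν k := by
  set m := ∫ e, F e ∂configMeasure μ ν k with hm
  set r := remainder μ ν hk F with hr
  set φ := proj μ ν hk F with hφ
  have hr2 := memLp_remainder μ ν hk hF hF2
  have hφ2 := memLp_proj μ ν hk hF hF2
  have hs2 : MemLp (fun e : Config 𝒳 𝒴 k => ∑ p, φ (e.1 p)) 2 (configMeasure μ ν k) :=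
    memLp_finsetSum _ fun p _ => memLp_point hφ2 p
  have hint : ∀ p, Integrable (fun e : Config 𝒳 𝒴 k => φ (e.1 p) * r e) (configMeasure μ ν k) :=
    fun p => (memLp_point hφ2 p).integrable_mul hr2
  have hcross : ∫ e : Config 𝒳 𝒴 k, (∑ p, φ (e.1 p)) * r e ∂configMeasure μ ν k = 0 := by
    simp_rw [Finset.sum_mul]
    rw [integral_finsetSum _ fun p _ => hint p]
    refine Finset.sum_eq_zero fun p _ => ?_
    have := (isDegenerate_remainder μ ν hk hF hF2 hsymm).integral_point_mul_eq_zero hk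
      (measurable_remainder μ ν hk hF) hr2 (measurable_proj μ ν hk hF) hφ2
      (Function.Embedding.refl _) p
    simpa only [restrict_refl] using this
  have hcross_int : Integrable (fun e : Config 𝒳 𝒴 k => (∑ p, φ (e.1 p)) * r e)
      (configMeasure μ ν k) := hs2.integrable_mul hr2
  have e1 : ∀ e, (F e - m) ^ 2
      = r e ^ 2 + 2 * ((∑ p, φ (e.1 p)) * r e) + (∑ p, φ (e.1 p)) ^ 2 := fun e => by
    simp only [hr, remainder]
    ring
  have h1 : ∫ e, (F e - m) ^ 2 ∂configMeasure μ ν k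
      = ∫ e, r e ^ 2 ∂configMeasure μ ν k + ∫ e, (∑ p, φ (e.1 p)) ^ 2 ∂configMeasure μ ν k := by
    simp_rw [e1]
    have i1 : Integrable (fun e => r e ^ 2 + 2 * ((∑ p, φ (e.1 p)) * r e)) (configMeasure μ ν k) :=
      hr2.integrable_sq.add (hcross_int.const_mul 2)
    rw [integral_add i1 hs2.integrable_sq,
      integral_add hr2.integrable_sq (hcross_int.const_mul 2), integral_const_mul, hcross]
    ring
  have h2 : ∫ e, (F e - m) ^ 2 ∂configMeasure μ ν k
      = ∫ e, F e ^ 2 ∂configMeasure μ ν k - m ^ 2 := by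
    rw [← variance_eq_integral hF.aemeasurable, variance_eq_sub hF2]
    rfl
  have h3 : 0 ≤ ∫ e : Config 𝒳 𝒴 k, (∑ p, φ (e.1 p)) ^ 2 ∂configMeasure μ ν k :=
    integral_nonneg fun e => sq_nonneg _
  nlinarith [sq_nonneg m]

end Kernel

/-! ### Counting pairs of index sets with two common points -/

section Counting

open Config

variable {k n : ℕ}

open Classical in
/-- The increasing maps of indices. -/
noncomputable def increasing (k n : ℕ) : Finset (Fin k ↪ Fin n) :=
  Finset.univ.filter fun α => StrictMono α

lemma mem_increasing {α : Fin k ↪ Fin n} : α ∈ increasing k n ↔ StrictMono α := by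
  simp [increasing]

lemma verts_injOn : Set.InjOn (verts : (Fin k ↪ Fin n) → _) (increasing k n) := by
  intro α hα β hβ h
  rw [Finset.mem_coe, mem_increasing] at hα hβ
  have hr : Set.range α = Set.range β := by
    ext i
    rw [← mem_verts, ← mem_verts, h]
  have := (hα.range_inj hβ).1 hr
  exact DFunLike.coe_injective this

lemma image_verts : (increasing k n).image verts = Finset.powersetCard k Finset.univ := by
  ext s
  simp only [Finset.mem_image, Finset.mem_powersetCard, Finset.subset_univ, true_and]
  constructor
  · rintro ⟨α, -, rfl⟩
    exact card_verts α
  · intro hs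
    refine ⟨(s.orderEmbOfFin hs).toEmbedding, ?_, ?_⟩
    · rw [mem_increasing]
      exact (s.orderEmbOfFin hs).strictMono
    · ext i
      rw [mem_verts, ← Finset.mem_coe, ← Finset.range_orderEmbOfFin s hs]
      rfl

/-- The number of increasing maps whose range contains a given set. -/
lemma card_increasing_filter (T : Finset (Fin n)) (hT : T.card ≤ k) :
    ((increasing k n).filter fun α => T ⊆ verts α).card = (n - T.card).choose (k - T.card) := by
  have h := Finset.card_filter_powersetCard_subset T Finset.univ k (Finset.subset_univ _) hT
  rw [Finset.card_univ, Fintype.card_fin, ← image_verts, Finset.filter_image,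
    Finset.card_image_of_injOn (verts_injOn.mono fun α hα => ?_)] at h
  · exact h
  · exact (Finset.mem_filter.1 hα).1

/-- The increasing maps whose range contains `i`. -/
noncomputable def increasingAt (k n : ℕ) (i : Fin n) : Finset (Fin k ↪ Fin n) :=
  (increasing k n).filter fun α => i ∈ verts α

lemma card_increasingAt (hk : 1 ≤ k) (i : Fin n) :
    (increasingAt k n i).card = (n - 1).choose (k - 1) := by
  simpa [increasingAt] using card_increasing_filter (k := k) {i} (by simpa using hk)

/-- The number of pairs of index maps in `𝒜` whose ranges have at least two common points. -/
def overlaps (𝒜 : Finset (Fin k ↪ Fin n)) : ℕ :=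
  ∑ α ∈ 𝒜, ∑ β ∈ 𝒜, if 2 ≤ (verts α ∩ verts β).card then 1 else 0

/-- For `α` through `i`, an overlapping `β` through `i` contains `{i, j}` for one of the `k - 1`
other points `j` of `α`; a union bound over `j` suffices. -/
lemma overlaps_increasingAt_le (hk : 1 ≤ k) (i : Fin n) :
    overlaps (increasingAt k n i)
      ≤ (n - 1).choose (k - 1) * ((k - 1) * (n - 2).choose (k - 2)) := by
  rw [← card_increasingAt hk i, overlaps, ← smul_eq_mul]
  refine Finset.sum_le_card_nsmul _ _ _ fun α hα => ?_
  have hiα : i ∈ verts α := (Finset.mem_filter.1 hα).2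
  rw [← Finset.card_filter]
  have hsub : (increasingAt k n i).filter (fun β => 2 ≤ (verts α ∩ verts β).card)
      ⊆ ((verts α).erase i).biUnion fun j =>
        (increasing k n).filter fun β => ({i, j} : Finset (Fin n)) ⊆ verts β := by
    intro β hβ
    simp only [Finset.mem_filter, increasingAt] at hβ
    obtain ⟨⟨hβ, hiβ⟩, h2⟩ := hβ
    obtain ⟨j, hj, hji⟩ := Finset.exists_mem_ne (lt_of_lt_of_le one_lt_two h2) i
    rw [Finset.mem_inter] at hj
    simp only [Finset.mem_biUnion, Finset.mem_filter, Finset.mem_erase]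
    refine ⟨j, ⟨hji, hj.1⟩, hβ, ?_⟩
    intro x hx
    rw [Finset.mem_insert, Finset.mem_singleton] at hx
    rcases hx with rfl | rfl
    · exact hiβ
    · exact hj.2
  refine (Finset.card_le_card hsub).trans (Finset.card_biUnion_le.trans ?_)
  have hc : ((verts α).erase i).card = k - 1 := by
    rw [Finset.card_erase_of_mem hiα, card_verts]
  rw [← hc, ← smul_eq_mul]
  refine Finset.sum_le_card_nsmul _ _ _ fun j hj => ?_
  have hij : i ≠ j := (Finset.ne_of_mem_erase hj).symm
  have h2 : ({i, j} : Finset (Fin n)).card = 2 := Finset.card_pair hij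
  have hk2 : 2 ≤ k := by
    rw [← h2, ← card_verts α]
    refine Finset.card_le_card fun x hx => ?_
    rw [Finset.mem_insert, Finset.mem_singleton] at hx
    rcases hx with rfl | rfl
    · exact hiα
    · exact Finset.mem_of_mem_erase hj
  rw [card_increasing_filter _ (by rw [h2]; exact hk2), h2]

/-- The identity `(n - 1) * (n - 2).choose (k - 2) = (k - 1) * (n - 1).choose (k - 1)` turns the
count into `(k - 1) ^ 2 / (n - 1)` times the squared binomial, and this factor is at most `k ^ 2 /
n` since `k ≤ n`. -/
lemma mul_overlaps_increasingAt_le (hk : 1 ≤ k) (hkn : k ≤ n) (i : Fin n) :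
    n * overlaps (increasingAt k n i) ≤ k ^ 2 * (n - 1).choose (k - 1) ^ 2 := by
  have h := overlaps_increasingAt_le hk i
  -- For `k = 1` the truncated `k - 2` is harmless: the factor `k - 1` already vanishes.
  rcases Nat.lt_or_ge k 2 with h2 | h2
  · obtain rfl : k = 1 := by lia
    simp only [Nat.sub_self, zero_mul, mul_zero, Nat.le_zero] at h
    simp [h]
  obtain ⟨k, rfl⟩ := Nat.exists_eq_add_of_le' h2
  obtain ⟨n, rfl⟩ := Nat.exists_eq_add_of_le' (h2.trans hkn)
  have hc : (n + 1) * n.choose k = (n + 1).choose (k + 1) * (k + 1) :=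
    Nat.add_one_mul_choose_eq n k
  simp only [Nat.add_sub_cancel, show n + 2 - 1 = n + 1 by lia,
    show k + 2 - 1 = k + 1 by lia] at h ⊢
  set M := (n + 1).choose (k + 1)
  set N := n.choose k
  set O := overlaps (increasingAt (k + 2) (n + 2) i)
  have hk' : k ≤ n := by lia
  have h3 : (n + 1) * O ≤ (k + 1) ^ 2 * M ^ 2 := by
    calc (n + 1) * O ≤ (n + 1) * (M * ((k + 1) * N)) := Nat.mul_le_mul_left _ h
      _ = M * (k + 1) * ((n + 1) * N) := by ring
      _ = (k + 1) ^ 2 * M ^ 2 := by rw [hc]; ring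
  have h4 : (n + 2) * (k + 1) ^ 2 ≤ (k + 2) ^ 2 * (n + 1) := by
    obtain ⟨d, rfl⟩ := Nat.exists_eq_add_of_le hk'
    ring_nf
    nlinarith
  have h5 : (n + 1) * ((n + 2) * O) ≤ (n + 1) * ((k + 2) ^ 2 * M ^ 2) := by
    calc (n + 1) * ((n + 2) * O) = (n + 2) * ((n + 1) * O) := by ring
      _ ≤ (n + 2) * ((k + 1) ^ 2 * M ^ 2) := Nat.mul_le_mul_left _ h3
      _ = (n + 2) * (k + 1) ^ 2 * M ^ 2 := by ring
      _ ≤ (k + 2) ^ 2 * (n + 1) * M ^ 2 := Nat.mul_le_mul_right _ h4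
      _ = (n + 1) * ((k + 2) ^ 2 * M ^ 2) := by ring
  exact Nat.le_of_mul_le_mul_left h5 (Nat.succ_pos n)

/-- Summing the counts through `i` over all `i` counts each overlapping pair once per common index,
hence at least twice. -/
lemma two_mul_overlaps_increasing_le (hk : 1 ≤ k) (hkn : k ≤ n) :
    2 * overlaps (increasing k n) ≤ k ^ 2 * (n - 1).choose (k - 1) ^ 2 := by
  have h1 : 2 * overlaps (increasing k n) ≤ ∑ i, overlaps (increasingAt k n i) := by
    simp only [overlaps, increasingAt, Finset.mul_sum, Finset.sum_filter]
    rw [Finset.sum_comm (s := (Finset.univ : Finset (Fin n)))]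
    refine Finset.sum_le_sum fun α _ => ?_
    have : ∀ i : Fin n, (if i ∈ verts α then
        (∑ β ∈ increasing k n, if i ∈ verts β then
          (if 2 ≤ (verts α ∩ verts β).card then 1 else 0) else 0) else 0)
        = ∑ β ∈ increasing k n, if i ∈ verts α ∩ verts β then
          (if 2 ≤ (verts α ∩ verts β).card then 1 else 0) else 0 := by
      intro i
      by_cases hi : i ∈ verts α <;> simp [hi]
    simp_rw [this]
    rw [Finset.sum_comm (s := (Finset.univ : Finset (Fin n)))]
    refine Finset.sum_le_sum fun β _ => ?_
    rw [← Finset.sum_filter, Finset.filter_mem_eq_inter, Finset.univ_inter, Finset.sum_const,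
      smul_eq_mul]
    split_ifs with h <;> lia
  have hn : 0 < n := lt_of_lt_of_le hk hkn
  have h2 : n * ∑ i, overlaps (increasingAt k n i) ≤ n * (k ^ 2 * (n - 1).choose (k - 1) ^ 2) := by
    rw [Finset.mul_sum]
    refine (Finset.sum_le_sum fun i _ => mul_overlaps_increasingAt_le hk hkn i).trans ?_
    simp
  exact h1.trans (Nat.le_of_mul_le_mul_left h2 hn)

end Counting

/-! ### Second and fourth moment inequalities -/

section Moments

variable {E : Type*} [MeasurableSpace E] {P : Measure E}

/-- **Cauchy-Schwarz** for square integrable functions, in the form in which bounds for the second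
moments are given. -/
lemma integral_abs_mul_le {X Y : E → ℝ} (hX : MemLp X 2 P) (hY : MemLp Y 2 P) {a b c : ℝ}
    (ha : ∫ e, X e ^ 2 ∂P ≤ a) (hb : ∫ e, Y e ^ 2 ∂P ≤ b) (hc : 0 ≤ c) (habc : a * b ≤ c ^ 2) :
    ∫ e, |X e * Y e| ∂P ≤ c := by
  set C := ∫ e, |X e * Y e| ∂P with hC
  have hX0 : 0 ≤ ∫ e, X e ^ 2 ∂P := integral_nonneg fun e => sq_nonneg _
  have hY0 : 0 ≤ ∫ e, Y e ^ 2 ∂P := integral_nonneg fun e => sq_nonneg _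
  have hXY : Integrable (fun e => |X e * Y e|) P := (hX.integrable_mul hY).abs
  -- The mean of `(t * |X| - |Y|) ^ 2` is nonnegative for all `t`, so its discriminant in `t` is
  -- nonpositive.
  have hq : ∀ t : ℝ, 0 ≤ (∫ e, X e ^ 2 ∂P) * (t * t) + (-2 * C) * t + ∫ e, Y e ^ 2 ∂P := by
    intro t
    have h : 0 ≤ ∫ e, (t * t * X e ^ 2 + (-2 * t) * |X e * Y e| + Y e ^ 2) ∂P := by
      refine integral_nonneg fun e => ?_
      simp only [Pi.zero_apply, abs_mul]
      nlinarith [sq_nonneg (t * |X e| - |Y e|), sq_abs (X e), sq_abs (Y e)]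
    have i1 : Integrable (fun e => t * t * X e ^ 2 + (-2 * t) * |X e * Y e|) P :=
      (hX.integrable_sq.const_mul _).add (hXY.const_mul _)
    rw [integral_add i1 hY.integrable_sq, integral_add (hX.integrable_sq.const_mul _)
      (hXY.const_mul _), integral_const_mul, integral_const_mul] at h
    linarith
  have hd := discrim_le_zero hq
  rw [discrim] at hd
  refine abs_le_of_sq_le_sq' ?_ hc |>.2
  nlinarith [mul_le_mul ha hb hY0 (hX0.trans ha)]

lemma integral_abs_le_of_sq_le [IsProbabilityMeasure P] {X : E → ℝ} (hX : MemLp X 2 P) {c : ℝ}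
    (hc : 0 ≤ c) (h : ∫ e, X e ^ 2 ∂P ≤ c ^ 2) : ∫ e, |X e| ∂P ≤ c := by
  simpa using integral_abs_mul_le hX (memLp_const 1) (b := 1) h (by simp) hc (by simp)

/-- The second moment of a sum of orthogonal square integrable functions. -/
lemma integral_sum_sq_of_orthogonal {ι : Type*} (s : Finset ι) {X : ι → E → ℝ}
    (hX : ∀ i ∈ s, MemLp (X i) 2 P)
    (horth : ∀ i ∈ s, ∀ j ∈ s, i ≠ j → ∫ e, X i e * X j e ∂P = 0) :
    ∫ e, (∑ i ∈ s, X i e) ^ 2 ∂P = ∑ i ∈ s, ∫ e, X i e ^ 2 ∂P := by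
  have hint : ∀ i ∈ s, ∀ j ∈ s, Integrable (fun e => X i e * X j e) P :=
    fun i hi j hj => (hX i hi).integrable_mul (hX j hj)
  simp_rw [sq (∑ i ∈ s, _), Finset.sum_mul_sum]
  rw [integral_finsetSum _ fun i hi => integrable_finsetSum _ fun j hj => hint i hi j hj]
  refine Finset.sum_congr rfl fun i hi => ?_
  rw [integral_finsetSum _ fun j hj => hint i hi j hj, Finset.sum_eq_single_of_mem i hi]
  · simp_rw [sq]
  · exact fun j hj hji => horth i hi j hj hji.symm

/-- Centring increases the fourth moment by a factor of at most three. -/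
lemma integral_sub_integral_pow_four_le [IsProbabilityMeasure P] {X : E → ℝ}
    (hX : Integrable X P) (hX4 : Integrable (fun e => X e ^ 4) P) :
    Integrable (fun e => (X e - ∫ e, X e ∂P) ^ 4) P ∧
      ∫ e, (X e - ∫ e, X e ∂P) ^ 4 ∂P ≤ 3 * ∫ e, X e ^ 4 ∂P := by
  set m := ∫ e, X e ∂P with hm
  -- A multiple of `x - m` may be added freely, as its mean is zero; this one makes the difference
  -- of the sides a nonnegative quartic form in `x` and `m`.
  have hle : ∀ x : ℝ, (x - m) ^ 4 ≤ 3 * x ^ 4 + -13 * m ^ 3 * (x - m) := by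
    intro x
    nlinarith [sq_nonneg (x ^ 2 + x * m - 2.2 * m ^ 2), sq_nonneg (x * m), sq_nonneg (m * m),
      sq_nonneg (x * m - m * m)]
  have hi : Integrable (fun e => 3 * X e ^ 4 + -13 * m ^ 3 * (X e - m)) P :=
    (hX4.const_mul 3).add ((hX.sub (integrable_const m)).const_mul _)
  have hi4 : Integrable (fun e => (X e - m) ^ 4) P := by
    refine hi.mono' ((hX.1.sub aestronglyMeasurable_const).pow 4) (Filter.Eventually.of_forall ?_)
    intro e
    rw [Real.norm_of_nonneg (by positivity)]
    exact hle _
  refine ⟨hi4, ?_⟩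
  have h := integral_mono hi4 hi fun e => hle (X e)
  have i2 : Integrable (fun e => -13 * m ^ 3 * (X e - m)) P :=
    (hX.sub (integrable_const m)).const_mul _
  rw [integral_add (hX4.const_mul 3) i2, integral_const_mul,
    integral_const_mul, integral_sub hX (integrable_const m), ← hm] at h
  simpa using h

/-- The variance of `X ^ 2` is nonnegative. -/
lemma sq_integral_sq_le [IsProbabilityMeasure P] {X : E → ℝ} (hXm : AEStronglyMeasurable X P)
    (hX4 : Integrable (fun e => X e ^ 4) P) :
    MemLp X 2 P ∧ (∫ e, X e ^ 2 ∂P) ^ 2 ≤ ∫ e, X e ^ 4 ∂P := by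
  have h2 : MemLp (fun e => X e ^ 2) 2 P := by
    refine (memLp_two_iff_integrable_sq (hXm.pow 2)).2 ?_
    convert hX4 using 2 with e
    simp only [Pi.pow_apply]
    ring
  refine ⟨(memLp_two_iff_integrable_sq hXm).2 (h2.integrable one_le_two), ?_⟩
  have h := variance_nonneg (fun e => X e ^ 2) P
  rw [variance_eq_sub h2] at h
  have e : ∫ e, X e ^ 4 ∂P = ∫ e, ((fun e => X e ^ 2) ^ 2) e ∂P := by
    congr 1 with e
    simp only [Pi.pow_apply]
    ring
  rw [e]
  linarith

/-- The fourth moment of the difference of two independent copies. -/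
lemma integral_sub_pow_four_le [IsProbabilityMeasure P] {X : E → ℝ} (hXm : AEStronglyMeasurable X P)
    (hX4 : Integrable (fun e => X e ^ 4) P) (hX0 : ∫ e, X e ∂P = 0) :
    Integrable (fun p : E × E => (X p.1 - X p.2) ^ 4) (P.prod P) ∧
      ∫ p, (X p.1 - X p.2) ^ 4 ∂P.prod P ≤ 8 * ∫ e, X e ^ 4 ∂P := by
  obtain ⟨hX2, hle⟩ := sq_integral_sq_le hXm hX4
  have hX1 := hX2.integrable one_le_two
  have hX3 : Integrable (fun e => X e ^ 3) P := by
    refine (hX2.integrable_sq.add hX4).mono' (hXm.pow 3) (Filter.Eventually.of_forall fun e => ?_)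
    simp only [Pi.add_apply, Real.norm_eq_abs, abs_pow]
    rw [← sq_abs, ← (Even.pow_abs (by decide : Even 4) (X e))]
    nlinarith [sq_nonneg (|X e| - 1), sq_nonneg (|X e|), abs_nonneg (X e),
      mul_nonneg (sq_nonneg (|X e|)) (sq_nonneg (|X e| - 1))]
  -- The terms with a first power vanish by centring, which leaves `2 E X⁴ + 6 (E X²)² ≤ 8 E X⁴`.
  have e : ∀ p : E × E, (X p.1 - X p.2) ^ 4 = X p.1 ^ 4 + (-4 * X p.1 ^ 3) * X p.2
      + (6 * X p.1 ^ 2) * X p.2 ^ 2 + (-4 * X p.1) * X p.2 ^ 3 + X p.2 ^ 4 := fun p => by ring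
  have i1 : Integrable (fun p : E × E => X p.1 ^ 4) (P.prod P) := hX4.comp_fst P
  have i2 : Integrable (fun p : E × E => (-4 * X p.1 ^ 3) * X p.2) (P.prod P) :=
    (hX3.const_mul (-4)).mul_prod hX1
  have i3 : Integrable (fun p : E × E => (6 * X p.1 ^ 2) * X p.2 ^ 2) (P.prod P) :=
    (hX2.integrable_sq.const_mul 6).mul_prod hX2.integrable_sq
  have i4 : Integrable (fun p : E × E => (-4 * X p.1) * X p.2 ^ 3) (P.prod P) :=
    (hX1.const_mul (-4)).mul_prod hX3
  have i5 : Integrable (fun p : E × E => X p.2 ^ 4) (P.prod P) := hX4.comp_snd P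
  have i12 : Integrable (fun p : E × E => X p.1 ^ 4 + (-4 * X p.1 ^ 3) * X p.2) (P.prod P) :=
    i1.add i2
  have i123 : Integrable (fun p : E × E => X p.1 ^ 4 + (-4 * X p.1 ^ 3) * X p.2
      + (6 * X p.1 ^ 2) * X p.2 ^ 2) (P.prod P) := i12.add i3
  have i1234 : Integrable (fun p : E × E => X p.1 ^ 4 + (-4 * X p.1 ^ 3) * X p.2
      + (6 * X p.1 ^ 2) * X p.2 ^ 2 + (-4 * X p.1) * X p.2 ^ 3) (P.prod P) := i123.add i4
  simp_rw [e]
  refine ⟨i1234.add i5, ?_⟩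
  rw [integral_add i1234 i5, integral_add i123 i4, integral_add i12 i3, integral_add i1 i2,
    integral_fun_fst (fun e => X e ^ 4), integral_fun_snd (fun e => X e ^ 4),
    integral_prod_mul (fun e => -4 * X e ^ 3) X,
    integral_prod_mul (fun e => 6 * X e ^ 2) (fun e => X e ^ 2),
    integral_prod_mul (fun e => -4 * X e) (fun e => X e ^ 3), integral_const_mul,
    integral_const_mul, integral_const_mul, hX0]
  simp
  nlinarith

end Moments

/-! ### Swapping a single point, with all labels kept -/

section SwapPoint

open Config

variable {𝒳 𝒴 : Type*} {k n : ℕ}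

/-- Swap the `i`-th points of two configurations. -/
def swapPoint (i : Fin n) : Config 𝒳 𝒴 n × Config 𝒳 𝒴 n → Config 𝒳 𝒴 n × Config 𝒳 𝒴 n :=
  exchange {i}ᶜ Finset.univ

lemma swapPoint_self (i : Fin n) (p : Config 𝒳 𝒴 n × Config 𝒳 𝒴 n) :
    (swapPoint i p).1.1 i = p.2.1 i := by
  simp [swapPoint, exchange, mix]

lemma swapPoint_self_snd (i : Fin n) (p : Config 𝒳 𝒴 n × Config 𝒳 𝒴 n) :
    (swapPoint i p).2.1 i = p.1.1 i := by
  simp [swapPoint, exchange, mix]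

lemma swapPoint_of_ne {i j : Fin n} (h : j ≠ i) (p : Config 𝒳 𝒴 n × Config 𝒳 𝒴 n) :
    (swapPoint i p).1.1 j = p.1.1 j := by
  simp [swapPoint, exchange, mix, h]

lemma swapPoint_of_ne_snd {i j : Fin n} (h : j ≠ i) (p : Config 𝒳 𝒴 n × Config 𝒳 𝒴 n) :
    (swapPoint i p).2.1 j = p.2.1 j := by
  simp [swapPoint, exchange, mix, h]

lemma restrict_swapPoint {α : Fin k ↪ Fin n} {i : Fin n} (h : i ∉ verts α)
    (p : Config 𝒳 𝒴 n × Config 𝒳 𝒴 n) : (swapPoint i p).1.restrict α = p.1.restrict α :=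
  restrict_mix_of_subset (fun j hj => by
    rw [Finset.mem_compl, Finset.mem_singleton]
    exact fun hji => h (hji ▸ hj)) (Finset.subset_univ _) p

/-- The sum of a kernel over all increasing maps of indices. -/
noncomputable def kernelSum (n : ℕ) (F : Config 𝒳 𝒴 k → ℝ) (e : Config 𝒳 𝒴 n) : ℝ :=
  ∑ α ∈ increasing k n, F (restrict α e)

/-- The difference of the remainder sums at two configurations that are related by `swapPoint i`
involves only the index maps whose range contains `i`. -/
lemma kernelSum_sub_swapPoint (F : Config 𝒳 𝒴 k → ℝ) (i : Fin n)
    (p : Config 𝒳 𝒴 n × Config 𝒳 𝒴 n) :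
    kernelSum n F p.1 - kernelSum n F (swapPoint i p).1
      = ∑ α ∈ increasingAt k n i, F (restrict α p.1)
        - ∑ α ∈ increasingAt k n i, F (restrict α (swapPoint i p).1) := by
  simp only [kernelSum, increasingAt, ← Finset.sum_sub_distrib]
  rw [Finset.sum_filter]
  refine Finset.sum_congr rfl fun α _ => ?_
  split_ifs with h
  · rfl
  · rw [restrict_swapPoint h, sub_self]

end SwapPoint

/-! ### Sums of functions of the individual points -/

section Points

open Config

variable {𝒳 𝒴 : Type*} {n : ℕ} [MeasurableSpace 𝒳] [MeasurableSpace 𝒴]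
  {μ : Measure 𝒳} {ν : Measure 𝒴} [IsProbabilityMeasure μ] [IsProbabilityMeasure ν]

lemma integral_point {u : 𝒳 → ℝ} (hu : Measurable u) (i : Fin n) :
    ∫ e : Config 𝒳 𝒴 n, u (e.1 i) ∂configMeasure μ ν n = ∫ t, u t ∂μ :=
  integral_comp_eq (measurePreserving_point μ ν i) hu.aestronglyMeasurable

lemma integral_point_mul_point {u : 𝒳 → ℝ} (hu : Measurable u) (hu2 : MemLp u 2 μ)
    (hu0 : ∫ t, u t ∂μ = 0) {i j : Fin n} (hij : i ≠ j) :
    ∫ e : Config 𝒳 𝒴 n, u (e.1 i) * u (e.1 j) ∂configMeasure μ ν n = 0 := by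
  have hm : ∀ i : Fin n, Measurable fun e : Config 𝒳 𝒴 n => u (e.1 i) := fun i =>
    hu.comp (by fun_prop)
  rw [integral_mul_eq_integral_mul_condMean μ ν (u := fun e => u (e.1 i))
    (F := fun e => u (e.1 j)) (hm j) (hm i)
    ((memLp_point hu2 i).integrable_mul (memLp_point hu2 j)) {i} ∅ i
    (fun p => by simp [mix]) (fun p => by rw [mix_singleton_empty])]
  refine integral_eq_zero_of_ae (Filter.Eventually.of_forall fun e => ?_)
  simp only [condMean, Config.update, Function.update_of_ne hij.symm, integral_point hu, hu0,
    mul_zero, Pi.zero_apply]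

lemma integral_sum_point_sq {u : 𝒳 → ℝ} (hu : Measurable u) (hu2 : MemLp u 2 μ)
    (hu0 : ∫ t, u t ∂μ = 0) :
    ∫ e : Config 𝒳 𝒴 n, (∑ i, u (e.1 i)) ^ 2 ∂configMeasure μ ν n = n * ∫ t, u t ^ 2 ∂μ := by
  rw [integral_sum_sq_of_orthogonal _ (fun i _ => memLp_point hu2 i)
    (fun i _ j _ hij => integral_point_mul_point hu hu2 hu0 hij)]
  simp_rw [integral_point (hu.pow_const 2)]
  simp

lemma measurePreserving_swapPoint (i : Fin n) :
    MeasurePreserving (swapPoint i : Config 𝒳 𝒴 n × Config 𝒳 𝒴 n → _)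
      ((configMeasure μ ν n).prod (configMeasure μ ν n))
      ((configMeasure μ ν n).prod (configMeasure μ ν n)) :=
  measurePreserving_exchange μ ν _ _

/-- The fluctuations of the sum of the signed squares of the differences of the points. -/
lemma integral_sum_signed_sq_le {u : 𝒳 → ℝ} (hu : Measurable u)
    (hu4 : Integrable (fun t => u t ^ 4) μ) (hu0 : ∫ t, u t ∂μ = 0) {c : ℝ} (hc : 0 ≤ c)
    (h : n * (8 * ∫ t, u t ^ 4 ∂μ) ≤ c ^ 2) :
    ∫ p : Config 𝒳 𝒴 n × Config 𝒳 𝒴 n,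
        |∑ i, |u (p.1.1 i) - u (p.2.1 i)| * (u (p.1.1 i) - u (p.2.1 i))|
      ∂(configMeasure μ ν n).prod (configMeasure μ ν n) ≤ c := by
  set Q := (configMeasure μ ν n).prod (configMeasure μ ν n) with hQ
  set X : Fin n → Config 𝒳 𝒴 n × Config 𝒳 𝒴 n → ℝ := fun i p =>
    |u (p.1.1 i) - u (p.2.1 i)| * (u (p.1.1 i) - u (p.2.1 i)) with hX
  have hmp : ∀ i : Fin n, MeasurePreserving (fun p : Config 𝒳 𝒴 n × Config 𝒳 𝒴 n =>
      (p.1.1 i, p.2.1 i)) Q (μ.prod μ) := fun i =>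
    (measurePreserving_point μ ν i).prod (measurePreserving_point μ ν i)
  have hXm : ∀ i, Measurable (X i) := fun i => by fun_prop
  obtain ⟨hi4, h4⟩ := integral_sub_pow_four_le hu.aestronglyMeasurable hu4 hu0
  have hsq : ∀ i p, X i p ^ 2 = (u (p.1.1 i) - u (p.2.1 i)) ^ 4 := fun i p => by
    simp only [hX, mul_pow, sq_abs]
    ring
  have hX2 : ∀ i, MemLp (X i) 2 Q := fun i => by
    refine (memLp_two_iff_integrable_sq (hXm i).aestronglyMeasurable).2 ?_
    simp_rw [hsq]
    exact (hmp i).integrable_comp_of_integrable hi4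
  refine integral_abs_le_of_sq_le (memLp_finsetSum _ fun i _ => hX2 i) hc ?_
  rw [integral_sum_sq_of_orthogonal _ fun i _ => hX2 i]
  · refine le_trans (le_of_eq_of_le ?_ (mul_le_mul_of_nonneg_left h4 (Nat.cast_nonneg n))) h
    have : ∀ i, ∫ p, X i p ^ 2 ∂Q = ∫ p, (u p.1 - u p.2) ^ 4 ∂μ.prod μ := fun i => by
      simp_rw [hsq]
      exact integral_comp_eq (u := fun p : 𝒳 × 𝒳 => (u p.1 - u p.2) ^ 4) (hmp i) hi4.1
    simp_rw [this]
    simp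
  · intro i _ j _ hij
    -- Swapping the `i`-th points reverses the sign of `X i` and leaves `X j` unchanged.
    refine integral_eq_zero_of_comp_eq_neg (measurePreserving_swapPoint i)
      ((hXm i).mul (hXm j)).aestronglyMeasurable fun p => ?_
    simp only [hX, swapPoint_self, swapPoint_self_snd, swapPoint_of_ne hij.symm,
      swapPoint_of_ne_snd hij.symm]
    rw [abs_sub_comm (u (p.2.1 i))]
    ring

end Points

/-! ### Hoeffding decomposition and variance of the statistic -/

section Decomposition

open Config

variable {𝒳 𝒴 : Type*} {k n : ℕ} [MeasurableSpace 𝒳] [MeasurableSpace 𝒴]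
  {μ : Measure 𝒳} {ν : Measure 𝒴} [IsProbabilityMeasure μ] [IsProbabilityMeasure ν]
  {F : Config 𝒳 𝒴 k → ℝ}

lemma measurable_kernelSum (hF : Measurable F) : Measurable (kernelSum n F) :=
  Finset.measurable_sum _ fun α _ => hF.comp (measurable_restrict α)

lemma memLp_kernelSum {q : ℝ≥0∞} (hF : MemLp F q (configMeasure μ ν k)) :
    MemLp (kernelSum n F) q (configMeasure μ ν n) :=
  memLp_finsetSum _ fun α _ => memLp_restrict hF α

lemma integral_kernelSum (hF : Integrable F (configMeasure μ ν k)) :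
    ∫ e, kernelSum n F e ∂configMeasure μ ν n
      = (increasing k n).card * ∫ e, F e ∂configMeasure μ ν k := by
  have hint : ∀ α : Fin k ↪ Fin n, Integrable (fun e => F (restrict α e)) (configMeasure μ ν n) :=
    fun α => (measurePreserving_restrict μ ν α).integrable_comp_of_integrable hF
  simp only [kernelSum]
  rw [integral_finsetSum _ fun α _ => hint α,
    Finset.sum_congr rfl fun α _ => integral_comp_eq (measurePreserving_restrict μ ν α) hF.1]
  simp

/-- The Hoeffding decomposition of first order. -/
lemma kernelSum_sub_integral (hk : 1 ≤ k) (hF : Integrable F (configMeasure μ ν k))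
    (e : Config 𝒳 𝒴 n) :
    kernelSum n F e - ∫ e, kernelSum n F e ∂configMeasure μ ν n
      = (n - 1).choose (k - 1) * ∑ i, proj μ ν hk F (e.1 i)
        + kernelSum n (remainder μ ν hk F) e := by
  -- Double counting: each index lies in the ranges of `(n - 1).choose (k - 1)` increasing maps.
  have h1 : ∑ α ∈ increasing k n, ∑ p, proj μ ν hk F ((restrict α e).1 p)
      = (n - 1).choose (k - 1) * ∑ i, proj μ ν hk F (e.1 i) := by
    have : ∀ α ∈ increasing k n, ∑ p, proj μ ν hk F ((restrict α e).1 p)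
        = ∑ i, if i ∈ verts α then proj μ ν hk F (e.1 i) else 0 := fun α _ => by
      rw [← Finset.sum_filter, Finset.filter_mem_eq_inter, Finset.univ_inter, verts,
        Finset.sum_map]
      rfl
    rw [Finset.sum_congr rfl this, Finset.sum_comm, Finset.mul_sum]
    refine Finset.sum_congr rfl fun i _ => ?_
    rw [← Finset.sum_filter, Finset.sum_const, ← card_increasingAt hk i, nsmul_eq_mul]
    rfl
  rw [integral_kernelSum hF, ← h1]
  simp only [kernelSum, remainder, Finset.sum_sub_distrib]
  simp

/-- The linear and the degenerate parts are orthogonal, so their second moments add. In particular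
the linear part bounds the variance from below. -/
lemma variance_kernelSum (hk : 1 ≤ k) (hF : Measurable F) (hF2 : MemLp F 2 (configMeasure μ ν k))
    (hsymm : ∀ π : Equiv.Perm (Fin k), ∀ e, F (restrict π.toEmbedding e) = F e) :
    variance (kernelSum n F) (configMeasure μ ν n)
      = ((n - 1).choose (k - 1) : ℝ) ^ 2 * (n * ∫ t, proj μ ν hk F t ^ 2 ∂μ)
        + ∫ e, kernelSum n (remainder μ ν hk F) e ^ 2 ∂configMeasure μ ν n := by
  have hF1 := hF2.integrable one_le_two
  have hφm := measurable_proj μ ν hk hF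
  have hφ2 := memLp_proj μ ν hk hF hF2
  have hrm := measurable_remainder μ ν hk hF
  have hr2 := memLp_remainder μ ν hk hF hF2
  have hG2 : MemLp (fun e : Config 𝒳 𝒴 n => ∑ i, proj μ ν hk F (e.1 i)) 2 (configMeasure μ ν n) :=
    memLp_finsetSum _ fun i _ => memLp_point hφ2 i
  have hR2 : MemLp (kernelSum n (remainder μ ν hk F)) 2 (configMeasure μ ν n) := memLp_kernelSum hr2
  have hGR : Integrable (fun e : Config 𝒳 𝒴 n => (∑ i, proj μ ν hk F (e.1 i))
      * kernelSum n (remainder μ ν hk F) e) (configMeasure μ ν n) := hG2.integrable_mul hR2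
  have hcross : ∫ e : Config 𝒳 𝒴 n, (∑ i, proj μ ν hk F (e.1 i))
      * kernelSum n (remainder μ ν hk F) e ∂configMeasure μ ν n = 0 := by
    simp only [kernelSum]
    simp_rw [Finset.sum_mul_sum]
    have hint : ∀ (i : Fin n) (α : Fin k ↪ Fin n), Integrable (fun e : Config 𝒳 𝒴 n =>
        proj μ ν hk F (e.1 i) * remainder μ ν hk F (restrict α e)) (configMeasure μ ν n) :=
      fun i α => (memLp_point hφ2 i).integrable_mul (memLp_restrict hr2 α)
    rw [integral_finsetSum _ fun i _ => integrable_finsetSum _ fun α _ => hint i α]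
    refine Finset.sum_eq_zero fun i _ => ?_
    rw [integral_finsetSum _ fun α _ => hint i α]
    exact Finset.sum_eq_zero fun α _ => (isDegenerate_remainder μ ν hk hF hF2
      hsymm).integral_point_mul_eq_zero hk hrm hr2 hφm hφ2 α i
  rw [variance_eq_integral (measurable_kernelSum hF).aemeasurable]
  simp_rw [kernelSum_sub_integral hk hF1]
  have e1 : ∀ e : Config 𝒳 𝒴 n, (((n - 1).choose (k - 1) : ℝ) * ∑ i, proj μ ν hk F (e.1 i)
      + kernelSum n (remainder μ ν hk F) e) ^ 2
      = ((n - 1).choose (k - 1) : ℝ) ^ 2 * (∑ i, proj μ ν hk F (e.1 i)) ^ 2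
        + 2 * ((n - 1).choose (k - 1) : ℝ) * ((∑ i, proj μ ν hk F (e.1 i))
          * kernelSum n (remainder μ ν hk F) e)
        + kernelSum n (remainder μ ν hk F) e ^ 2 := fun e => by ring
  simp_rw [e1]
  have i1 : Integrable (fun e : Config 𝒳 𝒴 n =>
      ((n - 1).choose (k - 1) : ℝ) ^ 2 * (∑ i, proj μ ν hk F (e.1 i)) ^ 2
        + 2 * ((n - 1).choose (k - 1) : ℝ) * ((∑ i, proj μ ν hk F (e.1 i))
          * kernelSum n (remainder μ ν hk F) e)) (configMeasure μ ν n) :=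
    (hG2.integrable_sq.const_mul _).add (hGR.const_mul _)
  rw [integral_add i1 hR2.integrable_sq, integral_add (hG2.integrable_sq.const_mul _)
    (hGR.const_mul _), integral_const_mul, integral_const_mul, hcross,
    integral_sum_point_sq hφm hφ2 (integral_proj μ ν hk hF1)]
  ring

lemma integral_kernelSum_remainder_sq_le (hk : 1 ≤ k) (hkn : k ≤ n) (hF : Measurable F)
    (hF2 : MemLp F 2 (configMeasure μ ν k))
    (hsymm : ∀ π : Equiv.Perm (Fin k), ∀ e, F (restrict π.toEmbedding e) = F e) :
    ∫ e, kernelSum n (remainder μ ν hk F) e ^ 2 ∂configMeasure μ ν n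
      ≤ (k * (n - 1).choose (k - 1) : ℝ) ^ 2 / 2 * ∫ e, F e ^ 2 ∂configMeasure μ ν k := by
  have h := (isDegenerate_remainder μ ν hk hF hF2 hsymm).integral_sum_sq_le hk
    (measurable_remainder μ ν hk hF) (memLp_remainder μ ν hk hF hF2) (increasing k n)
  refine h.trans (mul_le_mul ?_ (integral_remainder_sq_le μ ν hk hF hF2 hsymm)
    (integral_nonneg fun e => sq_nonneg _) (by positivity))
  have h2 := two_mul_overlaps_increasing_le hk hkn
  rw [le_div_iff₀' two_pos]
  rw [overlaps, ← mul_pow] at h2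
  exact_mod_cast h2

/-- Only the maps through `i` feel a swap at `i`. The extra factor `n`, compared with the sum over
all maps, is what keeps the total of the `n` interaction terms of order `ε`. -/
lemma mul_integral_remainder_at_sq_le (hk : 1 ≤ k) (hkn : k ≤ n) (hF : Measurable F)
    (hF2 : MemLp F 2 (configMeasure μ ν k))
    (hsymm : ∀ π : Equiv.Perm (Fin k), ∀ e, F (restrict π.toEmbedding e) = F e) (i : Fin n) :
    n * ∫ e, (∑ α ∈ increasingAt k n i, remainder μ ν hk F (restrict α e)) ^ 2
      ∂configMeasure μ ν n
      ≤ (k * (n - 1).choose (k - 1) : ℝ) ^ 2 * ∫ e, F e ^ 2 ∂configMeasure μ ν k := by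
  have h := (isDegenerate_remainder μ ν hk hF hF2 hsymm).integral_sum_sq_le hk
    (measurable_remainder μ ν hk hF) (memLp_remainder μ ν hk hF hF2) (increasingAt k n i)
  refine (mul_le_mul_of_nonneg_left h (Nat.cast_nonneg n)).trans ?_
  rw [← mul_assoc]
  refine mul_le_mul ?_ (integral_remainder_sq_le μ ν hk hF hF2 hsymm)
    (integral_nonneg fun e => sq_nonneg _) (by positivity)
  have h2 := mul_overlaps_increasingAt_le hk hkn i
  rw [overlaps, ← mul_pow] at h2
  exact_mod_cast h2

end Decomposition

/-! ### The normal approximation on the product space -/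

section BerryEsseen

open Config

variable {𝒳 𝒴 : Type*} {k n : ℕ} [MeasurableSpace 𝒳] [MeasurableSpace 𝒴]
  {μ : Measure 𝒳} {ν : Measure 𝒴} [IsProbabilityMeasure μ] [IsProbabilityMeasure ν]
  {F : Config 𝒳 𝒴 k → ℝ}

/-- The variance of a conditional mean is at most its second moment, which Jensen bounds. It serves
to show `σ₁² ≤ ‖f‖₄²`. -/
lemma integral_proj_sq_le (hk : 1 ≤ k) (hF : Measurable F) (hF2 : MemLp F 2 (configMeasure μ ν k)) :
    ∫ t, proj μ ν hk F t ^ 2 ∂μ ≤ ∫ e, F e ^ 2 ∂configMeasure μ ν k := by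
  have hc := memLp_condMean μ ν hF hF2 ⟨0, hk⟩
  have h1 := variance_eq_integral (μ := μ) (measurable_condMean μ ν hF ⟨0, hk⟩).aemeasurable
  rw [integral_condMean μ ν (hF2.integrable one_le_two), variance_eq_sub hc] at h1
  have h2 : ∫ t, condMean μ ν F ⟨0, hk⟩ t ^ 2 ∂μ ≤ ∫ e, F e ^ 2 ∂configMeasure μ ν k := by
    rw [← integral_condMean μ ν hF2.integrable_sq ⟨0, hk⟩]
    exact integral_mono_ae hc.integrable_sq (integrable_condMean μ ν hF2.integrable_sq _)
      (condMean_sq_le μ ν hF hF2.integrable_sq _)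
  simp only [proj]
  rw [← h1]
  simp only [Pi.pow_apply]
  nlinarith [sq_nonneg (∫ t, condMean μ ν F ⟨0, hk⟩ t ∂μ)]

lemma integral_proj_pow_four_le (hk : 1 ≤ k) (hF : Measurable F)
    (hF4 : Integrable (fun e => F e ^ 4) (configMeasure μ ν k)) :
    Integrable (fun t => proj μ ν hk F t ^ 4) μ ∧
      ∫ t, proj μ ν hk F t ^ 4 ∂μ ≤ 3 * ∫ e, F e ^ 4 ∂configMeasure μ ν k := by
  have hF1 : Integrable F (configMeasure μ ν k) :=
    (sq_integral_sq_le hF.aestronglyMeasurable hF4).1.integrable one_le_two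
  obtain ⟨h1, h2⟩ := condMean_pow_four_le μ ν hF hF4 ⟨0, hk⟩
  obtain ⟨h3, h4⟩ := integral_sub_integral_pow_four_le (integrable_condMean μ ν hF1 ⟨0, hk⟩) h1
  rw [integral_condMean μ ν hF1] at h3 h4
  exact ⟨h3, h4.trans (by linarith)⟩

/-- The Berry-Esseen bound for sums `∑ i, g (e i) + R` that are normalized and whose remainder is
controlled in second moment. -/
lemma abs_measure_sub_stdCdf_le_of_remainder {g : 𝒳 → ℝ} {R : Config 𝒳 𝒴 n → ℝ}
    {Ri : Fin n → Config 𝒳 𝒴 n → ℝ} (hn : 0 < n) (hg : Measurable g)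
    (hg4 : Integrable (fun t => g t ^ 4) μ) (hg0 : ∫ t, g t ∂μ = 0) (hR : Measurable R)
    (hR2 : MemLp R 2 (configMeasure μ ν n)) (hRi2 : ∀ i, MemLp (Ri i) 2 (configMeasure μ ν n))
    (hRi : ∀ i p, R p.1 - R (swapPoint i p).1 = Ri i p.1 - Ri i (swapPoint i p).1) {ε : ℝ}
    (hε : 12 * ε ≤ 1) (hε0 : 0 ≤ ε)
    (h1 : n * ∫ t, g t ^ 2 ∂μ + ∫ e, R e ^ 2 ∂configMeasure μ ν n = 1)
    (h2 : ∫ e, R e ^ 2 ∂configMeasure μ ν n ≤ ε ^ 2 / 2)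
    (h4 : n * ∫ t, g t ^ 4 ∂μ ≤ 3 * ε ^ 2)
    (hi : ∀ i, ∫ e, Ri i e ^ 2 ∂configMeasure μ ν n ≤ (ε / n) ^ 2 * n) (z : ℝ) :
    |(configMeasure μ ν n).real {e | ∑ i, g (e.1 i) + R e ≤ z} - stdCdf z| ≤ 12 * ε := by
  set P := configMeasure μ ν n with hP
  have hn' : (0 : ℝ) < n := Nat.cast_pos.2 hn
  obtain ⟨hg2, hg24⟩ := sq_integral_sq_le hg.aestronglyMeasurable hg4
  set v := ∫ t, g t ^ 2 ∂μ with hv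
  have hgi2 : ∀ i : Fin n, MemLp (fun e : Config 𝒳 𝒴 n => g (e.1 i)) 2 P := memLp_point hg2
  have hgm : ∀ i : Fin n, Measurable fun e : Config 𝒳 𝒴 n => g (e.1 i) := fun i =>
    hg.comp (by fun_prop)
  have hvi : ∀ i : Fin n, ∫ e : Config 𝒳 𝒴 n, g (e.1 i) ^ 2 ∂P = v := fun i =>
    integral_point (u := fun t => g t ^ 2) (hg.pow_const 2) i
  have hmain := abs_measure_le_sub_stdCdf_le P (fun i e => g (e.1 i)) R swapPoint
    (fun i => measurePreserving_swapPoint i) (fun i p => exchange_exchange _ _ p) hgm hR hgi2 hR2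
    (fun i => by rw [integral_point hg, hg0]) (fun i p => by rw [swapPoint_self])
    (fun i j hij p => by rw [swapPoint_of_ne hij]) z
  refine hmain.trans ?_
  simp only [hvi]
  -- the remainder
  have t1 : ∫ e, |R e| ∂P ≤ 0.7072 * ε :=
    integral_abs_le_of_sq_le hR2 (by positivity) (h2.trans (by nlinarith [sq_nonneg ε]))
  -- the fluctuations of the sum of squares
  have hw2 : MemLp (fun t => g t ^ 2 - v) 2 μ := by
    have : MemLp (fun t => g t ^ 2) 2 μ := by
      refine (memLp_two_iff_integrable_sq (hg.pow_const 2).aestronglyMeasurable).2 ?_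
      convert hg4 using 2 with t
      ring
    exact this.sub (memLp_const _)
  have hwm : Measurable fun t => g t ^ 2 - v := (hg.pow_const 2).sub_const v
  have hw0 : ∫ t, (g t ^ 2 - v) ∂μ = 0 := by
    rw [integral_sub hg2.integrable_sq (integrable_const _)]
    simp [hv]
  have hw : ∫ t, (g t ^ 2 - v) ^ 2 ∂μ ≤ ∫ t, g t ^ 4 ∂μ := by
    have e : ∀ t, (g t ^ 2 - v) ^ 2 = g t ^ 4 - 2 * v * (g t ^ 2 - v) - v ^ 2 := fun t => by ring
    have i1 : Integrable (fun t => 2 * v * (g t ^ 2 - v)) μ :=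
      (hw2.integrable one_le_two).const_mul _
    have i2 : Integrable (fun t => g t ^ 4 - 2 * v * (g t ^ 2 - v)) μ := hg4.sub i1
    simp_rw [e]
    rw [integral_sub i2 (integrable_const _), integral_sub hg4 i1, integral_const_mul, hw0]
    simp [sq_nonneg]
  have hws2 : MemLp (fun e : Config 𝒳 𝒴 n => ∑ i, (g (e.1 i) ^ 2 - v)) 2 P :=
    memLp_finsetSum _ fun i _ => memLp_point hw2 i
  -- The variance of `g ^ 2` is at most its second moment, and `1.7321 ^ 2` exceeds the factor `3`
  -- of `h4`.
  have t2 : ∫ e : Config 𝒳 𝒴 n, |∑ i, (g (e.1 i) ^ 2 - v)| ∂P ≤ 1.7321 * ε := by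
    refine integral_abs_le_of_sq_le hws2 (by positivity) ?_
    rw [integral_sum_point_sq hwm hw2 hw0]
    have := mul_le_mul_of_nonneg_left hw hn'.le
    nlinarith [sq_nonneg ε]
  have t3 : ∫ e : Config 𝒳 𝒴 n, |1 - (∑ i, (g (e.1 i) ^ 2 + v)) / 2| ∂P
      ≤ ε / 24 + 0.86605 * ε := by
    have hle : ∀ e : Config 𝒳 𝒴 n, |1 - (∑ i, (g (e.1 i) ^ 2 + v)) / 2|
        ≤ ε / 24 + |∑ i, (g (e.1 i) ^ 2 - v)| / 2 := by
      intro e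
      have hs : ∑ i, (g (e.1 i) ^ 2 + v) = ∑ i, (g (e.1 i) ^ 2 - v) + 2 * (n * v) := by
        simp only [Finset.sum_add_distrib, Finset.sum_sub_distrib, Finset.sum_const,
          Finset.card_univ, Fintype.card_fin, nsmul_eq_mul]
        ring
      have h0 : 0 ≤ ∫ e, R e ^ 2 ∂P := integral_nonneg fun e => sq_nonneg _
      rw [hs]
      -- By `h1` the left side is the second moment of `R`, at most `ε ^ 2 / 2`, and `12 * ε ≤ 1`.
      have hb : 1 - n * v ≤ ε / 24 := by nlinarith
      have hb0 : 0 ≤ 1 - n * v := by linarith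
      have := abs_le.1 (le_refl |∑ i, (g (e.1 i) ^ 2 - v)|)
      rw [abs_le]
      constructor <;> linarith [this.1, this.2]
    have ii : Integrable (fun e : Config 𝒳 𝒴 n => ε / 24 + |∑ i, (g (e.1 i) ^ 2 - v)| / 2) P :=
      (integrable_const _).add ((hws2.integrable one_le_two).abs.div_const 2)
    refine (integral_mono_of_nonneg (Filter.Eventually.of_forall fun e => abs_nonneg _) ii
      (Filter.Eventually.of_forall hle)).trans ?_
    rw [integral_add (integrable_const _) ((hws2.integrable one_le_two).abs.div_const 2),
      integral_const, probReal_univ, one_smul]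
    have : ∫ e : Config 𝒳 𝒴 n, |∑ i, (g (e.1 i) ^ 2 - v)| / 2 ∂P
        = (∫ e : Config 𝒳 𝒴 n, |∑ i, (g (e.1 i) ^ 2 - v)| ∂P) / 2 := integral_div _ _
    linarith
  -- `4.9 ^ 2 > 24 = 8 * 3`, with `8` from the difference of two copies and `3` from `h4`.
  have t4 : ∫ p : Config 𝒳 𝒴 n × Config 𝒳 𝒴 n,
      |∑ i, |g (p.1.1 i) - g (p.2.1 i)| * (g (p.1.1 i) - g (p.2.1 i))| ∂P.prod P ≤ 4.9 * ε :=
    integral_sum_signed_sq_le hg hg4 hg0 (by positivity) (by nlinarith [sq_nonneg ε])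
  -- the interaction between the summands and the remainder
  have t5 : ∀ i : Fin n, ∫ p : Config 𝒳 𝒴 n × Config 𝒳 𝒴 n,
      |(g (p.1.1 i) - g (p.2.1 i)) * (R p.1 - R (swapPoint i p).1)| ∂P.prod P
        ≤ 2.8285 * (ε / n) := by
    intro i
    have hfst : MeasurePreserving (Prod.fst : Config 𝒳 𝒴 n × Config 𝒳 𝒴 n → _) (P.prod P) P :=
      measurePreserving_fst
    have hsnd : MeasurePreserving (Prod.snd : Config 𝒳 𝒴 n × Config 𝒳 𝒴 n → _) (P.prod P) P :=
      measurePreserving_snd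
    have hswap : MeasurePreserving (fun p : Config 𝒳 𝒴 n × Config 𝒳 𝒴 n => (swapPoint i p).1)
        (P.prod P) P := hfst.comp (measurePreserving_swapPoint i)
    have m1 : MemLp (fun p : Config 𝒳 𝒴 n × Config 𝒳 𝒴 n => g (p.1.1 i)) 2 (P.prod P) :=
      (hgi2 i).comp_measurePreserving hfst
    have m2 : MemLp (fun p : Config 𝒳 𝒴 n × Config 𝒳 𝒴 n => g (p.2.1 i)) 2 (P.prod P) :=
      (hgi2 i).comp_measurePreserving hsnd
    have m3 : MemLp (fun p : Config 𝒳 𝒴 n × Config 𝒳 𝒴 n => Ri i p.1) 2 (P.prod P) :=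
      (hRi2 i).comp_measurePreserving hfst
    have m4 : MemLp (fun p : Config 𝒳 𝒴 n × Config 𝒳 𝒴 n => Ri i (swapPoint i p).1) 2
        (P.prod P) := (hRi2 i).comp_measurePreserving hswap
    have q1 : ∫ p : Config 𝒳 𝒴 n × Config 𝒳 𝒴 n, (g (p.1.1 i) - g (p.2.1 i)) ^ 2 ∂P.prod P
        ≤ 2 / n := by
      have e : ∀ p : Config 𝒳 𝒴 n × Config 𝒳 𝒴 n, (g (p.1.1 i) - g (p.2.1 i)) ^ 2
          = g (p.1.1 i) ^ 2 + (-2 * g (p.1.1 i)) * g (p.2.1 i) + g (p.2.1 i) ^ 2 := fun p => by ring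
      have i2 : Integrable (fun p : Config 𝒳 𝒴 n × Config 𝒳 𝒴 n =>
          (-2 * g (p.1.1 i)) * g (p.2.1 i)) (P.prod P) := (m1.const_mul (-2)).integrable_mul m2
      have i12 : Integrable (fun p : Config 𝒳 𝒴 n × Config 𝒳 𝒴 n =>
          g (p.1.1 i) ^ 2 + (-2 * g (p.1.1 i)) * g (p.2.1 i)) (P.prod P) := m1.integrable_sq.add i2
      simp_rw [e]
      rw [integral_add i12 m2.integrable_sq, integral_add m1.integrable_sq i2,
        integral_prod_mul (fun e : Config 𝒳 𝒴 n => -2 * g (e.1 i))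
          (fun e : Config 𝒳 𝒴 n => g (e.1 i)),
        integral_point hg, hg0,
        integral_fun_fst (fun e : Config 𝒳 𝒴 n => g (e.1 i) ^ 2),
        integral_fun_snd (fun e : Config 𝒳 𝒴 n => g (e.1 i) ^ 2), hvi]
      have h0 : 0 ≤ ∫ e, R e ^ 2 ∂P := integral_nonneg fun e => sq_nonneg _
      have : v ≤ 1 / n := by
        rw [le_div_iff₀ hn']
        linarith
      have e2 : (2 : ℝ) / n = 1 / n + 1 / n := by ring
      simp
      rw [e2]
      simp only [one_div] at this ⊢
      linarith
    have q2 : ∫ p : Config 𝒳 𝒴 n × Config 𝒳 𝒴 n, (R p.1 - R (swapPoint i p).1) ^ 2 ∂P.prod P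
        ≤ 4 * ((ε / n) ^ 2 * n) := by
      simp_rw [hRi]
      have hle : ∫ p : Config 𝒳 𝒴 n × Config 𝒳 𝒴 n,
          (Ri i p.1 - Ri i (swapPoint i p).1) ^ 2 ∂P.prod P
          ≤ ∫ p : Config 𝒳 𝒴 n × Config 𝒳 𝒴 n,
            (2 * Ri i p.1 ^ 2 + 2 * Ri i (swapPoint i p).1 ^ 2) ∂P.prod P := by
        refine integral_mono (m3.sub m4).integrable_sq
          ((m3.integrable_sq.const_mul 2).add (m4.integrable_sq.const_mul 2)) fun p => ?_
        simp only
        nlinarith [sq_nonneg (Ri i p.1 + Ri i (swapPoint i p).1)]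
      rw [integral_add (m3.integrable_sq.const_mul 2) (m4.integrable_sq.const_mul 2),
        integral_const_mul, integral_const_mul,
        integral_comp_eq (u := fun e => Ri i e ^ 2) hfst (hRi2 i).integrable_sq.1,
        integral_comp_eq (u := fun e => Ri i e ^ 2) hswap (hRi2 i).integrable_sq.1] at hle
      linarith [hi i]
    -- Cauchy-Schwarz: the second moments multiply to `8 * (ε / n) ^ 2`, and `2.8285 ^ 2 > 8`.
    refine integral_abs_mul_le (m1.sub m2) ?_ q1 q2 (by positivity) ?_
    · exact (hR2.comp_measurePreserving hfst).sub (hR2.comp_measurePreserving hswap)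
    · have : (2 : ℝ) / n * (4 * ((ε / n) ^ 2 * n)) = 8 * (ε / n) ^ 2 := by
        field_simp
        ring
      rw [this]
      nlinarith [sq_nonneg (ε / n)]
  have t6 : ∑ i : Fin n, ∫ p : Config 𝒳 𝒴 n × Config 𝒳 𝒴 n,
      |(g (p.1.1 i) - g (p.2.1 i)) * (R p.1 - R (swapPoint i p).1)| ∂P.prod P ≤ 2.8285 * ε := by
    refine (Finset.sum_le_sum fun i _ => t5 i).trans (le_of_eq ?_)
    simp only [Finset.sum_const, Finset.card_univ, Fintype.card_fin, nsmul_eq_mul]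
    field_simp
  -- The coefficients of `ε` sum to `1 / 24 + 0.86605 + 1.26 * 0.7072 + 4.9 + 1.5 * 2.8285 < 10.95`.
  linarith

/-- The Berry-Esseen bound for the sum of a symmetric kernel over a random configuration. -/
theorem abs_measure_kernelSum_sub_stdCdf_le (hk : 1 ≤ k) (hkn : k ≤ n) (hF : Measurable F)
    (hF4 : Integrable (fun e => F e ^ 4) (configMeasure μ ν k))
    (hsymm : ∀ π : Equiv.Perm (Fin k), ∀ e, F (restrict π.toEmbedding e) = F e)
    (hσ : 0 < ∫ t, proj μ ν hk F t ^ 2 ∂μ) (z : ℝ) :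
    |(configMeasure μ ν n).real {e | (kernelSum n F e - ∫ e, kernelSum n F e ∂configMeasure μ ν n)
        / √(variance (kernelSum n F) (configMeasure μ ν n)) ≤ z} - stdCdf z|
      ≤ 12 * (k * √(∫ e, F e ^ 4 ∂configMeasure μ ν k) / (√n * ∫ t, proj μ ν hk F t ^ 2 ∂μ)) := by
  set P := configMeasure μ ν n with hP
  set σ2 := ∫ t, proj μ ν hk F t ^ 2 ∂μ with hσ2
  set Λ := √(∫ e, F e ^ 4 ∂configMeasure μ ν k) with hΛ
  set ε := k * Λ / (√n * σ2) with hε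
  have hn : 0 < n := lt_of_lt_of_le hk hkn
  have hn' : (0 : ℝ) < n := Nat.cast_pos.2 hn
  have hk' : (1 : ℝ) ≤ k := by exact_mod_cast hk
  have hΛ0 : 0 ≤ Λ := Real.sqrt_nonneg _
  have hε0 : 0 ≤ ε := by positivity
  -- If `12 * ε ≥ 1` the bound is trivial, as both probabilities lie in `[0, 1]`.
  rcases le_total (12 * ε) 1 with hε1 | hε1
  swap
  · refine le_trans ?_ hε1
    have p0 : 0 ≤ P.real {e | (kernelSum n F e - ∫ e, kernelSum n F e ∂P)
        / √(variance (kernelSum n F) P) ≤ z} := measureReal_nonneg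
    have p1 : P.real {e | (kernelSum n F e - ∫ e, kernelSum n F e ∂P)
        / √(variance (kernelSum n F) P) ≤ z} ≤ 1 := measureReal_le_one
    rw [abs_le]
    constructor <;> linarith [stdCdf_nonneg z, stdCdf_le_one z]
  obtain ⟨hF2, hF24⟩ := sq_integral_sq_le hF.aestronglyMeasurable hF4
  have hF1 := hF2.integrable one_le_two
  have hBΛ : ∫ e, F e ^ 2 ∂configMeasure μ ν k ≤ Λ := Real.le_sqrt_of_sq_le hF24
  have hΛ2 : Λ ^ 2 = ∫ e, F e ^ 4 ∂configMeasure μ ν k :=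
    Real.sq_sqrt (integral_nonneg fun e => by positivity)
  have hφm := measurable_proj μ ν hk hF
  obtain ⟨hφ4, hφ4le⟩ := integral_proj_pow_four_le hk hF hF4
  rw [← hΛ2] at hφ4le
  have hr2 := memLp_remainder μ ν hk hF hF2
  have hrm := measurable_remainder μ ν hk hF
  set M : ℝ := ((n - 1).choose (k - 1) : ℝ) with hM
  have hM0 : 0 < M := Nat.cast_pos.2 (Nat.choose_pos (by lia))
  set V := variance (kernelSum n F) P with hV
  have hVeq : V = M ^ 2 * (n * σ2) + ∫ e, kernelSum n (remainder μ ν hk F) e ^ 2 ∂P :=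
    variance_kernelSum hk hF hF2 hsymm
  have hR0 : 0 ≤ ∫ e, kernelSum n (remainder μ ν hk F) e ^ 2 ∂P :=
    integral_nonneg fun e => sq_nonneg _
  have hV0 : 0 < V := by
    rw [hVeq]
    positivity
  set s := √V with hs
  have hs0 : 0 < s := Real.sqrt_pos.2 hV0
  have hs2 : s ^ 2 = V := Real.sq_sqrt hV0.le
  have hsn : √(n : ℝ) ^ 2 = n := Real.sq_sqrt hn'.le
  have hsn0 : 0 < √(n : ℝ) := Real.sqrt_pos.2 hn'
  -- The second moment bounds below produce `y` to the first power only; since `y ≥ 1`, it may be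
  -- replaced by the `y ^ 2` occurring in `ε ^ 2 = k ^ 2 * y ^ 2 / n`.
  set y := Λ / σ2 with hy
  have hy1 : 1 ≤ y := by
    rw [hy, one_le_div hσ]
    exact (integral_proj_sq_le hk hF hF2).trans hBΛ
  have hyy : y ≤ y ^ 2 := by nlinarith
  have hΛy : Λ = y * σ2 := by
    rw [hy]
    field_simp
  have hε2 : ε ^ 2 = k ^ 2 * y ^ 2 / n := by
    rw [hε, hy, div_pow, mul_pow, mul_pow, hsn]
    field_simp
  set A := (M / s) ^ 2 with hA
  have hA0 : 0 ≤ A := sq_nonneg _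
  have hAV : A * V = M ^ 2 := by
    rw [hA, ← hs2]
    field_simp
  -- The variance dominates the contribution of its linear part.
  have hAσ : A * (n * σ2) ≤ 1 := by
    rw [hA, div_pow, hs2, div_mul_eq_mul_div, div_le_one hV0, hVeq]
    linarith
  have hAΛ : n * (A * Λ) ≤ y := by
    rw [hΛy]
    nlinarith
  have hAB : n * (A * ∫ e, F e ^ 2 ∂configMeasure μ ν k) ≤ y :=
    (mul_le_mul_of_nonneg_left (mul_le_mul_of_nonneg_left hBΛ hA0) hn'.le).trans hAΛ
  have hset : {e : Config 𝒳 𝒴 n | (kernelSum n F e - ∫ e, kernelSum n F e ∂P) / s ≤ z}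
      = {e | ∑ i, M / s * proj μ ν hk F (e.1 i) + kernelSum n (remainder μ ν hk F) e / s ≤ z} := by
    ext e
    rw [Set.mem_ofPred_eq, Set.mem_ofPred_eq, kernelSum_sub_integral hk hF1, ← Finset.mul_sum,
      add_div, mul_div_right_comm]
  rw [hset]
  have hRsq : ∫ e, (kernelSum n (remainder μ ν hk F) e / s) ^ 2 ∂P
      = (∫ e, kernelSum n (remainder μ ν hk F) e ^ 2 ∂P) / V := by
    simp_rw [div_pow, hs2]
    exact integral_div _ _
  have hgsq : ∫ t, (M / s * proj μ ν hk F t) ^ 2 ∂μ = A * σ2 := by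
    simp_rw [mul_pow]
    exact integral_const_mul _ _
  have hg4eq : ∫ t, (M / s * proj μ ν hk F t) ^ 4 ∂μ = A ^ 2 * ∫ t, proj μ ν hk F t ^ 4 ∂μ := by
    have : ∀ t, (M / s * proj μ ν hk F t) ^ 4 = A ^ 2 * proj μ ν hk F t ^ 4 := fun t => by
      rw [hA]
      ring
    simp_rw [this]
    exact integral_const_mul _ _
  refine abs_measure_sub_stdCdf_le_of_remainder (g := fun t => M / s * proj μ ν hk F t)
    (R := fun e => kernelSum n (remainder μ ν hk F) e / s)
    (Ri := fun i e => (∑ α ∈ increasingAt k n i, remainder μ ν hk F (restrict α e)) / s) hn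
    (hφm.const_mul _) ?_ ?_ ((measurable_kernelSum hrm).div_const s) ?_ ?_ ?_ hε1 hε0 ?_ ?_ ?_ ?_ z
  · simp_rw [mul_pow]
    exact hφ4.const_mul _
  · rw [integral_const_mul, integral_proj μ ν hk hF1, mul_zero]
  · simp_rw [div_eq_mul_inv]
    exact (memLp_kernelSum hr2).mul_const _
  · intro i
    simp_rw [div_eq_mul_inv]
    exact (memLp_finsetSum _ fun α _ => memLp_restrict hr2 α).mul_const _
  · intro i p
    rw [← sub_div, kernelSum_sub_swapPoint, sub_div]
  · rw [hRsq, hgsq, hA, div_pow, hs2]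
    field_simp
    linarith
  · rw [hRsq, div_le_iff₀ hV0, hε2]
    refine (integral_kernelSum_remainder_sq_le hk hkn hF hF2 hsymm).trans ?_
    rw [← hM, mul_pow, ← hAV]
    have : (k : ℝ) ^ 2 * (A * V) / 2 * ∫ e, F e ^ 2 ∂configMeasure μ ν k
        = V * (k ^ 2 / 2 * (n * (A * ∫ e, F e ^ 2 ∂configMeasure μ ν k)) / n) := by
      field_simp
    rw [this]
    have h2 : (k : ℝ) ^ 2 / 2 * (n * (A * ∫ e, F e ^ 2 ∂configMeasure μ ν k)) / n
        ≤ k ^ 2 * y ^ 2 / n / 2 := by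
      rw [div_div, mul_comm (n : ℝ) 2, ← div_div, div_le_div_iff_of_pos_right hn', div_mul_eq_mul_div,
        div_le_div_iff_of_pos_right two_pos]
      exact mul_le_mul_of_nonneg_left (hAB.trans hyy) (by positivity)
    rw [mul_comm V]
    exact mul_le_mul_of_nonneg_right h2 hV0.le
  · rw [hg4eq, hε2]
    have h3 : n * (A ^ 2 * (3 * Λ ^ 2)) = 3 * (n * (A * Λ)) ^ 2 / n := by
      field_simp
    have h5 : (n * (A * Λ)) ^ 2 ≤ y ^ 2 := pow_le_pow_left₀ (by positivity) hAΛ 2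
    have h6 : (1 : ℝ) ≤ k ^ 2 := one_le_pow₀ hk'
    calc n * (A ^ 2 * ∫ t, proj μ ν hk F t ^ 4 ∂μ) ≤ n * (A ^ 2 * (3 * Λ ^ 2)) := by gcongr
      _ = 3 * (n * (A * Λ)) ^ 2 / n := h3
      _ ≤ 3 * y ^ 2 / n := by gcongr
      _ ≤ 3 * (k ^ 2 * y ^ 2) / n := by
        gcongr
        exact le_mul_of_one_le_left (sq_nonneg y) h6
      _ = 3 * (k ^ 2 * y ^ 2 / n) := by ring
  · intro i
    simp_rw [div_pow, hs2]
    rw [integral_div, div_le_iff₀ hV0, hε2]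
    have h := mul_integral_remainder_at_sq_le hk hkn hF hF2 hsymm i
    rw [← hM, mul_pow, ← hAV] at h
    have h2 : (k : ℝ) ^ 2 * (A * V) * ∫ e, F e ^ 2 ∂configMeasure μ ν k
        ≤ k ^ 2 * V * y ^ 2 / n := by
      rw [le_div_iff₀ hn']
      calc (k : ℝ) ^ 2 * (A * V) * (∫ e, F e ^ 2 ∂configMeasure μ ν k) * n
          = k ^ 2 * V * (n * (A * ∫ e, F e ^ 2 ∂configMeasure μ ν k)) := by ring
        _ ≤ k ^ 2 * V * y ^ 2 := by
          exact mul_le_mul_of_nonneg_left (hAB.trans hyy) (by positivity)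
    refine le_of_mul_le_mul_left (h.trans (h2.trans (le_of_eq ?_))) hn'
    field_simp

end BerryEsseen

/-! ### Transfer from the product space to the given random variables -/

section Transfer

open Config

variable {Ω 𝒳 𝒴 : Type*} {k n : ℕ}

/-- The configuration formed by random points and labels. -/
def toConfig (X : Fin n → Ω → 𝒳) (Y : Edge n → Ω → 𝒴) (ω : Ω) : Config 𝒳 𝒴 n :=
  (fun i => X i ω, fun e => Y e ω)

lemma genUStat_eq_kernelSum (f : (Fin k → 𝒳) → (Edge k → 𝒴) → ℝ) (X : Fin n → Ω → 𝒳)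
    (Y : Edge n → Ω → 𝒴) (ω : Ω) :
    genUStat f X Y ω = kernelSum n (fun e => f e.1 e.2) (toConfig X Y ω) := by
  classical
  rw [genUStat, kernelSum]
  exact (Finset.sum_subtype (increasing k n) (fun α => mem_increasing)
    fun α => kernelAt f X Y α ω).symm

variable [MeasurableSpace Ω] [MeasurableSpace 𝒳] [MeasurableSpace 𝒴]
  {P : Measure Ω}

lemma measurePreserving_toConfig [IsProbabilityMeasure P] {X : Fin n → Ω → 𝒳} {Y : Edge n → Ω → 𝒴}
    (hXm : ∀ i, Measurable (X i)) (hYm : ∀ e, Measurable (Y e)) (hXindep : iIndepFun X P)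
    (hYindep : iIndepFun Y P) (hXY : IndepFun (fun ω i => X i ω) (fun ω e => Y e ω) P)
    {μ : Measure 𝒳} {ν : Measure 𝒴} (hμ : ∀ i, P.map (X i) = μ) (hν : ∀ e, P.map (Y e) = ν) :
    MeasurePreserving (toConfig X Y) P (configMeasure μ ν n) where
  measurable := (measurable_pi_lambda _ hXm).prodMk (measurable_pi_lambda _ hYm)
  map_eq := by
    have h := (indepFun_iff_map_prod_eq_prod_map_map
      (measurable_pi_lambda _ hXm).aemeasurable (measurable_pi_lambda _ hYm).aemeasurable).1 hXY
    rw [hXindep.map_fun_eq_pi_map fun i => (hXm i).aemeasurable,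
      hYindep.map_fun_eq_pi_map fun e => (hYm e).aemeasurable] at h
    simp_rw [hμ, hν] at h
    exact h

variable {μ : Measure 𝒳} {ν : Measure 𝒴} [IsProbabilityMeasure μ] [IsProbabilityMeasure ν]

/-- Events in the σ-algebra of the first point have indicators depending on that point alone, so
`integral_mul_eq_integral_mul_condMean` verifies the characterization of the conditional expectation
by set integrals. -/
lemma firstProjection_ae_eq [IsProbabilityMeasure P] {f : (Fin k → 𝒳) → (Edge k → 𝒴) → ℝ}
    (hfm : Measurable (fun p : Config 𝒳 𝒴 k => f p.1 p.2))
    (hf : Integrable (fun p : Config 𝒳 𝒴 k => f p.1 p.2) (configMeasure μ ν k))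
    {X : Fin n → Ω → 𝒳} {Y : Edge n → Ω → 𝒴}
    (hc : MeasurePreserving (toConfig X Y) P (configMeasure μ ν n)) (hXm : ∀ i, Measurable (X i))
    (hk : 1 ≤ k) (hkn : k ≤ n) :
    firstProjection P f X Y hk hkn =ᵐ[P] fun ω =>
      proj μ ν hk (fun p => f p.1 p.2) (X ⟨0, lt_of_lt_of_le hk hkn⟩ ω) := by
  set F : Config 𝒳 𝒴 k → ℝ := fun p => f p.1 p.2 with hF
  set i₀ : Fin n := ⟨0, lt_of_lt_of_le hk hkn⟩ with hi₀
  have hm := (hXm i₀).comap_le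
  have hinit : MeasurePreserving (fun ω => restrict (Fin.castLEEmb hkn) (toConfig X Y ω)) P
      (configMeasure μ ν k) := (measurePreserving_restrict μ ν (Fin.castLEEmb hkn)).comp hc
  have hpt : MeasurePreserving (X i₀) P μ := (measurePreserving_point μ ν i₀).comp hc
  have hint : Integrable (kernelInit f X Y hkn) P := hinit.integrable_comp_of_integrable hf
  have hmean : ∫ ω, kernelInit f X Y hkn ω ∂P = ∫ e, F e ∂configMeasure μ ν k :=
    integral_comp_eq hinit hf.1
  have hcm := measurable_condMean μ ν hfm ⟨0, hk⟩
  have hcX : Integrable (fun ω => condMean μ ν F ⟨0, hk⟩ (X i₀ ω)) P :=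
    hpt.integrable_comp_of_integrable (integrable_condMean μ ν hf ⟨0, hk⟩)
  have hcond : (fun ω => condMean μ ν F ⟨0, hk⟩ (X i₀ ω))
      =ᵐ[P] P[kernelInit f X Y hkn | MeasurableSpace.comap (X i₀) inferInstance] := by
    refine ae_eq_condExp_of_forall_setIntegral_eq hm hint (fun s _ _ => hcX.integrableOn) ?_ ?_
    · rintro _ ⟨t, ht, rfl⟩ -
      rw [← integral_indicator (hXm i₀ ht), ← integral_indicator (hXm i₀ ht)]
      set b : 𝒳 → ℝ := t.indicator 1 with hb
      have hbm : Measurable b := measurable_one.indicator ht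
      have e1 : ∀ u : Ω → ℝ, (X i₀ ⁻¹' t).indicator u = fun ω => b (X i₀ ω) * u ω := by
        intro u
        funext ω
        by_cases h : X i₀ ω ∈ t <;> simp [hb, Set.indicator, h]
      rw [e1, e1]
      have hbF : Integrable (fun e : Config 𝒳 𝒴 n => b (e.1 i₀)
          * F (restrict (Fin.castLEEmb hkn) e)) (configMeasure μ ν n) := by
        simp_rw [mul_comm (b _)]
        refine integrable_bounded_mul (C := 1) ((measurePreserving_restrict μ ν
          (Fin.castLEEmb hkn)).integrable_comp_of_integrable hf) (hbm.comp (by fun_prop)) fun e => ?_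
        by_cases h : e.1 i₀ ∈ t <;> simp [hb, h]
      have h1 : ∫ ω, b (X i₀ ω) * kernelInit f X Y hkn ω ∂P
          = ∫ e, b (e.1 i₀) * F (restrict (Fin.castLEEmb hkn) e) ∂configMeasure μ ν n :=
        integral_comp_eq (u := fun e => b (e.1 i₀) * F (restrict (Fin.castLEEmb hkn) e)) hc hbF.1
      have h2 : ∫ ω, b (X i₀ ω) * condMean μ ν F ⟨0, hk⟩ (X i₀ ω) ∂P
          = ∫ e : Config 𝒳 𝒴 n, b (e.1 i₀) * condMean μ ν F ⟨0, hk⟩ (e.1 i₀)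
            ∂configMeasure μ ν n :=
        integral_comp_eq (u := fun e : Config 𝒳 𝒴 n =>
            b (e.1 i₀) * condMean μ ν F ⟨0, hk⟩ (e.1 i₀)) hc
          ((hbm.comp (by fun_prop)).mul (hcm.comp (by fun_prop))).aestronglyMeasurable
      have h3 : ∀ t, condMean μ ν (fun e => F (restrict (Fin.castLEEmb hkn) e)) i₀ t
          = condMean μ ν F ⟨0, hk⟩ t :=
        fun t => condMean_restrict μ ν hfm (Fin.castLEEmb hkn) ⟨0, hk⟩ t
      rw [h1, h2, integral_mul_eq_integral_mul_condMean μ ν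
        (u := fun e : Config 𝒳 𝒴 n => b (e.1 i₀)) (F := fun e => F (restrict (Fin.castLEEmb hkn) e))
        (hfm.comp (measurable_restrict _)) (hbm.comp (by fun_prop)) hbF {i₀} ∅ i₀
        (fun p => by simp [mix]) (fun p => by rw [mix_singleton_empty])]
      simp_rw [h3]
    · exact (hcm.comp (comap_measurable (X i₀))).aestronglyMeasurable
  filter_upwards [hcond] with ω hω
  rw [firstProjection, ← hω, hmean]
  rfl

lemma eLpNorm_two_sq {E : Type*} [MeasurableSpace E] {Q : Measure E} {u : E → ℝ}
    (hu : MemLp u 2 Q) : eLpNorm u 2 Q ^ 2 = ENNReal.ofReal (∫ x, u x ^ 2 ∂Q) := by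
  rw [hu.eLpNorm_eq_integral_rpow_norm two_ne_zero ENNReal.ofNat_ne_top,
    ← ENNReal.ofReal_pow (by positivity)]
  have h0 : 0 ≤ ∫ x, u x ^ 2 ∂Q := integral_nonneg fun x => sq_nonneg _
  simp only [ENNReal.toReal_ofNat, Real.rpow_ofNat, Real.norm_eq_abs, sq_abs]
  rw [← Real.rpow_mul_natCast h0]
  norm_num

lemma eLpNorm_four_sq {E : Type*} [MeasurableSpace E] {Q : Measure E} {u : E → ℝ}
    (hu : MemLp u 4 Q) : eLpNorm u 4 Q ^ 2 = ENNReal.ofReal √(∫ x, u x ^ 4 ∂Q) := by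
  rw [hu.eLpNorm_eq_integral_rpow_norm (by norm_num) ENNReal.ofNat_ne_top,
    ← ENNReal.ofReal_pow (by positivity)]
  have h0 : 0 ≤ ∫ x, u x ^ 4 ∂Q := integral_nonneg fun x => by positivity
  simp only [ENNReal.toReal_ofNat, Real.rpow_ofNat, Real.norm_eq_abs,
    Even.pow_abs (by decide : Even 4)]
  rw [← Real.rpow_mul_natCast h0, Real.sqrt_eq_rpow]
  norm_num

lemma ofReal_twelve_mul (k : ℕ) {a s t : ℝ} (hs : 0 < s) (ht : 0 < t) :
    ENNReal.ofReal (12 * (k * a / (s * t)))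
      = 12 * k * ENNReal.ofReal a / (ENNReal.ofReal s * ENNReal.ofReal t) := by
  rw [← ENNReal.ofReal_mul hs.le, ← ENNReal.ofReal_natCast k, ← ENNReal.ofReal_ofNat 12,
    ← ENNReal.ofReal_mul (by norm_num), ← ENNReal.ofReal_mul (by positivity),
    ← ENNReal.ofReal_div_of_pos (by positivity)]
  congr 1
  ring

/-- The Berry-Esseen bound for a kernel sum of a random configuration with law `configMeasure`. -/
theorem iSup_abs_kernelSum_comp_le (hk : 1 ≤ k) (hkn : k ≤ n) {F : Config 𝒳 𝒴 k → ℝ}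
    (hF : Measurable F) (hsymm : ∀ π : Equiv.Perm (Fin k), ∀ e, F (restrict π.toEmbedding e) = F e)
    {c : Ω → Config 𝒳 𝒴 n} (hc : MeasurePreserving c P (configMeasure μ ν n)) {S g h : Ω → ℝ}
    (hS : S = fun ω => kernelSum n F (c ω))
    (hg : g = fun ω => F (restrict (Fin.castLEEmb hkn) (c ω))) (hg2 : MemLp g 2 P)
    (hh : h =ᵐ[P] fun ω => proj μ ν hk F ((c ω).1 ⟨0, lt_of_lt_of_le hk hkn⟩))
    (hσ : 0 < eLpNorm h 2 P) :
    ⨆ z : ℝ, ENNReal.ofReal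
        |P.real {ω | (S ω - ∫ ω', S ω' ∂P) / √(variance S P) ≤ z} - cdf (gaussianReal 0 1) z|
      ≤ 12 * (k : ℝ≥0∞) * eLpNorm g 4 P ^ 2 / (ENNReal.ofReal √(n : ℝ) * eLpNorm h 2 P ^ 2) := by
  have hn : 0 < n := lt_of_lt_of_le hk hkn
  have hinit : MeasurePreserving (fun ω => restrict (Fin.castLEEmb hkn) (c ω)) P
      (configMeasure μ ν k) := (measurePreserving_restrict μ ν (Fin.castLEEmb hkn)).comp hc
  have hnorm : ∀ q : ℝ≥0∞, eLpNorm g q P = eLpNorm F q (configMeasure μ ν k) := by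
    intro q
    rw [hg]
    exact eLpNorm_comp_measurePreserving (g := F) hF.aestronglyMeasurable hinit
  have hF2 : MemLp F 2 (configMeasure μ ν k) :=
    ⟨hF.aestronglyMeasurable, by rw [← hnorm]; exact hg2.2⟩
  have hφ2 := memLp_proj μ ν hk hF hF2
  have hproj : eLpNorm h 2 P = eLpNorm (proj μ ν hk F) 2 μ := by
    rw [eLpNorm_congr_ae hh]
    have hpt : MeasurePreserving (fun ω => (c ω).1 ⟨0, hn⟩) P μ :=
      (measurePreserving_point μ ν ⟨0, hn⟩).comp hc
    exact eLpNorm_comp_measurePreserving (g := proj μ ν hk F) hφ2.1 hpt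
  have hsq := eLpNorm_two_sq hφ2
  have hσ2 : 0 < ∫ t, proj μ ν hk F t ^ 2 ∂μ := by
    rw [hproj] at hσ
    have := ENNReal.pow_pos hσ 2
    rwa [hsq, ENNReal.ofReal_pos] at this
  rw [hproj, hnorm, hsq]
  -- With an infinite fourth moment the right side is `⊤`, since `12 * k ≠ 0` and the denominator is
  -- finite.
  by_cases h4 : eLpNorm F 4 (configMeasure μ ν k) = ⊤
  · rw [h4, ENNReal.top_pow two_ne_zero, ENNReal.mul_top, ENNReal.top_div_of_ne_top]
    · exact le_top
    · exact ENNReal.mul_ne_top ENNReal.ofReal_ne_top ENNReal.ofReal_ne_top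
    · have : (k : ℝ≥0∞) ≠ 0 := Nat.cast_ne_zero.2 (by lia)
      exact mul_ne_zero (by norm_num) this
  have hF4 : MemLp F 4 (configMeasure μ ν k) := ⟨hF.aestronglyMeasurable, lt_top_iff_ne_top.2 h4⟩
  have hF4i : Integrable (fun e => F e ^ 4) (configMeasure μ ν k) := by
    have := hF4.integrable_norm_pow (p := 4) (by norm_num)
    simpa [Even.pow_abs (by decide : Even 4)] using this
  have hsn : 0 < √(n : ℝ) := Real.sqrt_pos.2 (Nat.cast_pos.2 hn)
  refine iSup_le fun z => ?_
  have hbound := abs_measure_kernelSum_sub_stdCdf_le hk hkn hF hF4i hsymm hσ2 z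
  have hSm : Measurable (kernelSum n F) := measurable_kernelSum hF
  have hmean : ∫ ω', S ω' ∂P = ∫ e, kernelSum n F e ∂configMeasure μ ν n := by
    rw [hS]
    exact integral_comp_eq hc hSm.aestronglyMeasurable
  have hvar : variance S P = variance (kernelSum n F) (configMeasure μ ν n) := by
    rw [← hc.map_eq, variance_map hSm.aemeasurable hc.measurable.aemeasurable, hS]
    rfl
  have hprob : P.real {ω | (S ω - ∫ ω', S ω' ∂P) / √(variance S P) ≤ z}
      = (configMeasure μ ν n).real {e | (kernelSum n F e - ∫ e, kernelSum n F e ∂configMeasure μ ν n)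
        / √(variance (kernelSum n F) (configMeasure μ ν n)) ≤ z} := by
    rw [hmean, hvar, measureReal_def, measureReal_def, ← hc.measure_preimage, hS]
    · rfl
    · exact (measurableSet_le ((hSm.sub_const _).div_const _) measurable_const).nullMeasurableSet
  rw [hprob]
  refine (ENNReal.ofReal_le_ofReal hbound).trans (le_of_eq ?_)
  rw [eLpNorm_four_sq hF4]
  exact ofReal_twelve_mul k hsn hσ2

/-- The Berry-Esseen bound for generalized `U`-statistics, for labels with a given law. -/
theorem iSup_abs_genUStat_le [IsProbabilityMeasure P]
    (hk : 1 ≤ k) (hkn : k ≤ n) {X : Fin n → Ω → 𝒳} {Y : Edge n → Ω → 𝒴}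
    (hXm : ∀ i, Measurable (X i)) (hc : MeasurePreserving (toConfig X Y) P (configMeasure μ ν n))
    {f : (Fin k → 𝒳) → (Edge k → 𝒴) → ℝ} (hfm : Measurable (fun p : Config 𝒳 𝒴 k => f p.1 p.2))
    (hfsymm : IsSymmetricKernel f) (hf2 : MemLp (kernelInit f X Y hkn) 2 P)
    (hσ : 0 < eLpNorm (firstProjection P f X Y hk hkn) 2 P) :
    ⨆ z : ℝ, ENNReal.ofReal
        |P.real {ω | (genUStat f X Y ω - ∫ ω', genUStat f X Y ω' ∂P)
              / √(variance (genUStat f X Y) P) ≤ z}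
          - cdf (gaussianReal 0 1) z|
      ≤ 12 * (k : ℝ≥0∞) * eLpNorm (kernelInit f X Y hkn) 4 P ^ 2
          / (ENNReal.ofReal √(n : ℝ)
            * eLpNorm (firstProjection P f X Y hk hkn) 2 P ^ 2) := by
  have hinit : MeasurePreserving (fun ω => restrict (Fin.castLEEmb hkn) (toConfig X Y ω)) P
      (configMeasure μ ν k) := (measurePreserving_restrict μ ν (Fin.castLEEmb hkn)).comp hc
  have hint : Integrable (fun p : Config 𝒳 𝒴 k => f p.1 p.2) (configMeasure μ ν k) :=
    (hinit.integrable_comp hfm.aestronglyMeasurable).1 (hf2.integrable one_le_two)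
  exact iSup_abs_kernelSum_comp_le hk hkn hfm (fun π e => hfsymm π e.1 e.2) hc
    (funext fun ω => genUStat_eq_kernelSum f X Y ω) rfl hf2
    (firstProjection_ae_eq hfm hint hc hXm hk hkn) hσ

end Transfer

end GenUStat

theorem theorem2p1 {Ω 𝒳 𝒴 : Type*} [MeasurableSpace Ω] [MeasurableSpace 𝒳] [MeasurableSpace 𝒴]
    (P : Measure Ω) [IsProbabilityMeasure P]
    (k n : ℕ) (hk : 1 ≤ k) (hkn : k ≤ n)
    (X : Fin n → Ω → 𝒳) (Y : GenUStat.Edge n → Ω → 𝒴)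
    (hXm : ∀ i, Measurable (X i)) (hYm : ∀ e, Measurable (Y e))
    (hXindep : iIndepFun X P) (hYindep : iIndepFun Y P)
    (hXident : ∀ i j, IdentDistrib (X i) (X j) P P)
    (hYident : ∀ e e', IdentDistrib (Y e) (Y e') P P)
    (hXY : IndepFun (fun ω i => X i ω) (fun ω e => Y e ω) P)
    (f : (Fin k → 𝒳) → (GenUStat.Edge k → 𝒴) → ℝ)
    (hfm : Measurable (fun p : (Fin k → 𝒳) × (GenUStat.Edge k → 𝒴) => f p.1 p.2))
    (hfsymm : GenUStat.IsSymmetricKernel f)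
    (hf2 : MemLp (GenUStat.kernelInit f X Y hkn) 2 P)
    (σ₁ : ℝ≥0∞) (hσ₁ : σ₁ = eLpNorm (GenUStat.firstProjection P f X Y hk hkn) 2 P)
    (hσ₁pos : 0 < σ₁) :
    ⨆ z : ℝ, ENNReal.ofReal
        |P.real {ω | (GenUStat.genUStat f X Y ω - ∫ ω', GenUStat.genUStat f X Y ω' ∂P)
              / √(variance (GenUStat.genUStat f X Y) P) ≤ z}
          - cdf (gaussianReal 0 1) z|
      ≤ 12 * (k : ℝ≥0∞) * eLpNorm (GenUStat.kernelInit f X Y hkn) 4 P ^ 2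
          / (ENNReal.ofReal √(n : ℝ) * σ₁ ^ 2) := by
  subst hσ₁
  set i₀ : Fin n := ⟨0, lt_of_lt_of_le hk hkn⟩
  have hμp : IsProbabilityMeasure (P.map (X i₀)) :=
    Measure.isProbabilityMeasure_map (hXm i₀).aemeasurable
  have hμ : ∀ i, P.map (X i) = P.map (X i₀) := fun i => (hXident i i₀).map_eq
  rcases isEmpty_or_nonempty (GenUStat.Edge n) with hE | ⟨⟨e₀⟩⟩
  · -- without labels, the space `𝒴` may be empty and is replaced by a one-point space
    let Y' : GenUStat.Edge n → Ω → Unit := fun _ _ => ()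
    let f' : (Fin k → 𝒳) → (GenUStat.Edge k → Unit) → ℝ := fun x _ =>
      f x fun e => (hE.false (e.map (Fin.castLEEmb hkn))).elim
    have hEk : IsEmpty (GenUStat.Edge k) := ⟨fun e => hE.false (e.map (Fin.castLEEmb hkn))⟩
    have hat : GenUStat.kernelAt f X Y = GenUStat.kernelAt f' X Y' := by
      funext α ω
      exact congrArg (f _) (Subsingleton.elim _ _)
    have hinit : GenUStat.kernelInit f X Y hkn = GenUStat.kernelInit f' X Y' hkn := by
      simp only [GenUStat.kernelInit, hat]
    have hgen : GenUStat.genUStat f X Y = GenUStat.genUStat f' X Y' := by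
      funext ω
      simp only [GenUStat.genUStat, hat]
    have hfirst : GenUStat.firstProjection P f X Y hk hkn
        = GenUStat.firstProjection P f' X Y' hk hkn := by
      funext ω
      simp only [GenUStat.firstProjection, hinit]
    -- There are no labels, so any probability measure on `Unit` serves as their law.
    have hc := GenUStat.measurePreserving_toConfig (Y := Y') (ν := Measure.dirac ()) hXm
      (fun e => (hE.false e).elim) hXindep iIndepFun.of_subsingleton
      (indepFun_const_right (fun ω i => X i ω) fun _ => ()) hμ (fun e => (hE.false e).elim)
    rw [hfirst] at hσ₁pos ⊢
    rw [hinit] at hf2 ⊢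
    rw [hgen]
    refine GenUStat.iSup_abs_genUStat_le hk hkn hXm hc ?_ (fun π x y => ?_) hf2 hσ₁pos
    · exact hfm.comp (measurable_fst.prodMk measurable_const)
    · refine Eq.trans ?_ (hfsymm π x _)
      exact congrArg (f _) (Subsingleton.elim _ _)
  · have hνp : IsProbabilityMeasure (P.map (Y e₀)) :=
      Measure.isProbabilityMeasure_map (hYm e₀).aemeasurable
    exact GenUStat.iSup_abs_genUStat_le hk hkn hXm (GenUStat.measurePreserving_toConfig hXm hYm
      hXindep hYindep hXY hμ fun e => (hYident e e₀).map_eq) hfm hfsymm hf2 hσ₁pos
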